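/- **Proposition.** Let $p,q\in[0,1]$ satisfy $\rho:=1-p-q>0$ and let $\beta\in[0,1)$. Consider the following discounted restless bandit (Gilbert–Elliott channel transmission model). The state $X_t\in\mathsf X=[0,1]$ is the posterior probability that a hidden two-state Markov channel is good, where $p$ and $q$ are the probabilities of the transitions good $\to$ bad and bad $\to$ good. The action is $A_t\in\{0,1\}$, with $1$ active (transmit) and $0$ passive. The reward is $r(x,a)=ax$ and the resource consumption is $c(x,a)=a$. From state $x$, action $1$ leads to $q+\rho$ with probability $x$ and to $q$ with probability $1-x$, while action $0$ leads to $q+\rho x$. For a history-dependent randomized policy $\pi$ and an initial state $x$ put $$F(x,\pi)=\mathsf E_x^\pi\Big[\sum_{t\ge0}\beta^t r(X_t,A_t)\Big],\qquad G(x,\pi)=\mathsf E_x^\pi\Big[\sum_{t\ge0}\beta^t c(X_t,A_t)\Big],$$ and, writing $\langle a,\pi\rangle$ for the policy that takes action $a$ at time $0$ and follows $\pi$ from time $1$ on, $$f(x,\pi)=F(x,\langle1,\pi\rangle)-F(x,\langle0,\pi\rangle),\qquad g(x,\pi)=G(x,\langle1,\pi\rangle)-G(x,\langle0,\pi\rangle).$$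 For $z\in\overline{\mathbb R}=[-\infty,\infty]$, the $z$-policy is active iff $X_t>z$ and the $z^-$-policy is active iff $X_t\ge z$; $F(x,z),G(x,z),f(x,z),g(x,z)$ denote the metrics of the $z$-policy. Let $m^*(x)=f(x,x)/g(x,x)$ for $x\in\mathsf X$, extended to $\mathbb R$ by $m^*(z)=m^*(0)$ for $z<0$ and $m^*(z)=m^*(1)$ for $z>1$. Then the model is PCL-indexable, that is: 1. $g(x,z)>0$ for all $x\in\mathsf X$ and $z\in\overline{\mathbb R}$ (so $m^*$ is well defined); 2. $m^*$ is nondecreasing, continuous and bounded below on $\mathsf X$; 3. for each $x\in\mathsf X$, $G(x,\cdot)$ is nonincreasing and right-continuous on $\mathbb R$, and for all real $z_1<z_2$ the following Lebesgue–Stieltjes integral exists, is finite and satisfies $$F(x,z_2)-F(x,z_1)=\int_{(z_1,z_2]}m^*(z)\,G(x,dz).$$ Moreover, the model is strongly threshold-indexable with Whittle index $m^*$. Explicitly, for $\lambda\in\mathbb R$ let $V^*_\lambda(x)=\sup_\pi\{F(x,\pi)-\lambda G(x,\pi)\}$, the supremum being over all history-dependent randomized policies, and call a policy $\lambda$-optimal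 if it attains $V^*_\lambda(x)$ for every $x\in\mathsf X$. Let $\kappa^a(x,\cdot)$ be the transition law of action $a$ from state $x$. Call action $a$ $\lambda$-optimal in state $x$ if it maximizes $r(x,a)-\lambda c(x,a)+\beta\int V^*_\lambda(y)\,\kappa^a(x,dy)$ over $a\in\{0,1\}$. Then for every $\lambda\in\mathbb R$: * action $1$ is $\lambda$-optimal in $x$ iff $m^*(x)\ge\lambda$, and action $0$ is $\lambda$-optimal in $x$ iff $m^*(x)\le\lambda$; * there is a threshold $z\in\overline{\mathbb R}$ such that both the $z$-policy and the $z^-$-policy are $\lambda$-optimal. -/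

import Mathlib

open MeasureTheory ProbabilityTheory Set

noncomputable section

/-- A restless project (bandit) on the state interval `[ℓ, u]`. Action `true` is the active action
and `false` the passive one; `transition a` is the Markov kernel of action `a`. The last fields are
the standing assumptions of the discounted weighted-supremum-norm setting. -/
structure RestlessProject (ℓ u : ℝ) where
  lower_lt_upper : ℓ < u
  discount : ℝ
  discount_nonneg : 0 ≤ discount
  discount_lt_one : discount < 1
  reward : Icc ℓ u → Bool → ℝ
  resource : Icc ℓ u → Bool → ℝ
  transition : Bool → Kernel (Icc ℓ u) (Icc ℓ u)
  isMarkov : ∀ a, IsMarkovKernel (transition a)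
  continuous_reward : ∀ a, Continuous fun x => reward x a
  continuous_resource : ∀ a, Continuous fun x => resource x a
  resource_nonneg : ∀ x, 0 ≤ resource x false
  resource_lt : ∀ x, resource x false < resource x true
  weight : ∃ (w : Icc ℓ u → ℝ) (M γ : ℝ), Measurable w ∧ (∀ x, 1 ≤ w x) ∧ 0 < M ∧
    discount ≤ γ ∧ γ < 1 ∧
    ∀ a x, max |reward x a| (resource x a) ≤ M * w x ∧
      Integrable w (transition a x) ∧ discount * ∫ y, w y ∂(transition a x) ≤ γ * w x

/-- History-dependent randomized policies on a state space `X`: `first` draws the action `A₀` given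
`X₀`, and `next n` draws `A_{n+1}` given `((X₀, A₀), …, (X_n, A_n); X_{n+1})`. -/
structure ControlPolicy (X : Type*) [MeasurableSpace X] where
  first : Kernel X Bool
  next : ∀ n : ℕ, Kernel ((Finset.Iic n → X × Bool) × X) Bool
  isMarkov_first : IsMarkovKernel first
  isMarkov_next : ∀ n, IsMarkovKernel (next n)

namespace ControlPolicy

variable {X : Type*} [MeasurableSpace X]

open Classical in
lemma measurable_decide_mem {B : Set X} (hB : MeasurableSet B) :
    Measurable fun x => decide (x ∈ B) := by
  refine measurable_to_bool ?_
  convert hB using 1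
  ext x
  simp

open Classical in
/-- The stationary deterministic choice of the active action exactly on `B`. -/
def regionKernel (B : Set X) (hB : MeasurableSet B) : Kernel X Bool :=
  Kernel.deterministic (fun x => decide (x ∈ B)) (measurable_decide_mem hB)

/-- The stationary deterministic policy with active region `B`. -/
def ofRegion (B : Set X) (hB : MeasurableSet B) : ControlPolicy X where
  first := regionKernel B hB
  next _ := (regionKernel B hB).comap Prod.snd measurable_snd
  isMarkov_first := by unfold regionKernel; infer_instance
  isMarkov_next _ := by unfold regionKernel; infer_instance

/-- Forget the first period of a history of length `n + 2`. -/
def dropFirst (n : ℕ) (h : (Finset.Iic (n + 1) → X × Bool) × X) :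
    (Finset.Iic n → X × Bool) × X :=
  (fun i => h.1 ⟨i.1 + 1, Finset.mem_Iic.2 (Nat.succ_le_succ (Finset.mem_Iic.1 i.2))⟩, h.2)

lemma measurable_dropFirst (n : ℕ) : Measurable (dropFirst (X := X) n) := by
  unfold dropFirst
  fun_prop

/-- The policy `⟨a, π⟩`: take action `a` in period `0`, then follow `π` from period `1` onwards. -/
def precede (a : Bool) (π : ControlPolicy X) : ControlPolicy X where
  first := Kernel.const X (Measure.dirac a)
  next
    | 0 => π.first.comap Prod.snd measurable_snd
    | n + 1 => (π.next n).comap (dropFirst n) (measurable_dropFirst n)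
  isMarkov_first := inferInstance
  isMarkov_next
    | 0 => by have := π.isMarkov_first; infer_instance
    | n + 1 => by have := π.isMarkov_next n; infer_instance

end ControlPolicy

namespace RestlessProject

variable {ℓ u : ℝ} (P : RestlessProject ℓ u)

/-- The transition law as a kernel from state-action pairs to states. -/
def jointTransition : Kernel (Icc ℓ u × Bool) (Icc ℓ u) where
  toFun k := P.transition k.2 k.1
  measurable' := measurable_from_prod_countable_left fun a => (P.transition a).measurable

instance : IsMarkovKernel P.jointTransition :=
  ⟨fun k => (P.isMarkov k.2).isProbabilityMeasure k.1⟩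

/-- The conditional law of `(X_{n+1}, A_{n+1})` given `(X_0, A_0), …, (X_n, A_n)` under `π`. -/
def stepKernel (π : ControlPolicy (Icc ℓ u)) (n : ℕ) :
    Kernel (Finset.Iic n → Icc ℓ u × Bool) (Icc ℓ u × Bool) :=
  (P.jointTransition.comap (fun h => h ⟨n, Finset.mem_Iic.2 le_rfl⟩) (by fun_prop)).compProd
    (π.next n)

instance (π : ControlPolicy (Icc ℓ u)) (n : ℕ) : IsMarkovKernel (P.stepKernel π n) := by
  have := π.isMarkov_next n
  unfold stepKernel
  infer_instance

/-- The Ionescu-Tulcea law of the state-action path under `π` with `X_0 = x`. -/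
def pathMeasure (x : Icc ℓ u) (π : ControlPolicy (Icc ℓ u)) : Measure (ℕ → Icc ℓ u × Bool) :=
  Kernel.trajMeasure (X := fun _ => Icc ℓ u × Bool)
    ((Measure.dirac x).compProd π.first) (P.stepKernel π)

/-- Reward performance metric `F(x, π)`. -/
def rewardMetric (x : Icc ℓ u) (π : ControlPolicy (Icc ℓ u)) : ℝ :=
  ∫ ω, ∑' t : ℕ, P.discount ^ t * P.reward (ω t).1 (ω t).2 ∂(P.pathMeasure x π)

/-- Resource performance metric `G(x, π)`. -/
def resourceMetric (x : Icc ℓ u) (π : ControlPolicy (Icc ℓ u)) : ℝ :=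
  ∫ ω, ∑' t : ℕ, P.discount ^ t * P.resource (ω t).1 (ω t).2 ∂(P.pathMeasure x π)

/-- Net value `V_c(x, π) = F(x, π) - c G(x, π)` at resource price `c`. -/
def netValue (c : ℝ) (x : Icc ℓ u) (π : ControlPolicy (Icc ℓ u)) : ℝ :=
  P.rewardMetric x π - c * P.resourceMetric x π

/-- Optimal value function over all history-dependent randomized policies. -/
def optimalValue (c : ℝ) (x : Icc ℓ u) : ℝ :=
  ⨆ π : ControlPolicy (Icc ℓ u), P.netValue c x π

/-- `π` is optimal for the price-`c` problem, from every initial state. -/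
def IsOptimal (c : ℝ) (π : ControlPolicy (Icc ℓ u)) : Prop :=
  ∀ x, P.netValue c x π = P.optimalValue c x

/-- One-step lookahead value of action `a`: the operator `v ↦ r(x,a) - c·c(x,a) + β ∫ v dκᵃ(x,·)`
applied to the optimal value function. -/
def actionValue (c : ℝ) (a : Bool) (x : Icc ℓ u) : ℝ :=
  P.reward x a - c * P.resource x a +
    P.discount * ∫ y, P.optimalValue c y ∂(P.transition a x)

/-- The set of states where action `a` is optimal at price `c`. -/
def optimalActionSet (c : ℝ) (a : Bool) : Set (Icc ℓ u) :=
  {x | P.actionValue c (!a) x ≤ P.actionValue c a x}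

/-- The project is indexable with index `idx`. -/
def IsIndexableWith (idx : Icc ℓ u → ℝ) : Prop :=
  ∀ c : ℝ, P.optimalActionSet c true = {x | c ≤ idx x} ∧
    P.optimalActionSet c false = {x | idx x ≤ c}

end RestlessProject

lemma measurableSet_above {ℓ u : ℝ} (z : EReal) :
    MeasurableSet {x : Icc ℓ u | z < ((x : ℝ) : EReal)} :=
  measurableSet_lt measurable_const (measurable_coe_real_ereal.comp measurable_subtype_coe)

lemma measurableSet_atLeast {ℓ u : ℝ} (z : EReal) :
    MeasurableSet {x : Icc ℓ u | z ≤ ((x : ℝ) : EReal)} :=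
  measurableSet_le measurable_const (measurable_coe_real_ereal.comp measurable_subtype_coe)

/-- The `z`-policy: active iff the state is strictly above `z`. -/
def thresholdPolicy (ℓ u : ℝ) (z : EReal) : ControlPolicy (Icc ℓ u) :=
  .ofRegion {x | z < ((x : ℝ) : EReal)} (measurableSet_above z)

/-- The `z⁻`-policy: active iff the state is at least `z`. -/
def thresholdPolicyLeft (ℓ u : ℝ) (z : EReal) : ControlPolicy (Icc ℓ u) :=
  .ofRegion {x | z ≤ ((x : ℝ) : EReal)} (measurableSet_atLeast z)

namespace RestlessProject

variable {ℓ u : ℝ} (P : RestlessProject ℓ u)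

/-- The project is strongly threshold-indexable, with index `idx`. -/
def IsStronglyThresholdIndexableWith (idx : Icc ℓ u → ℝ) : Prop :=
  P.IsIndexableWith idx ∧ ∀ c : ℝ, ∃ z : EReal,
    P.IsOptimal c (thresholdPolicy ℓ u z) ∧ P.IsOptimal c (thresholdPolicyLeft ℓ u z)

/-- Marginal reward metric `f(x, π) = F(x, ⟨1, π⟩) - F(x, ⟨0, π⟩)`. -/
def marginalReward (x : Icc ℓ u) (π : ControlPolicy (Icc ℓ u)) : ℝ :=
  P.rewardMetric x (π.precede true) - P.rewardMetric x (π.precede false)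

/-- Marginal resource metric `g(x, π) = G(x, ⟨1, π⟩) - G(x, ⟨0, π⟩)`. -/
def marginalResource (x : Icc ℓ u) (π : ControlPolicy (Icc ℓ u)) : ℝ :=
  P.resourceMetric x (π.precede true) - P.resourceMetric x (π.precede false)

/-- Marginal productivity index `m*(x) = f(x, x) / g(x, x)`; it is meaningful when `g(x, x) ≠ 0`
for every state `x`. -/
def mpIndex (x : Icc ℓ u) : ℝ :=
  P.marginalReward x (thresholdPolicy ℓ u ((x : ℝ) : EReal)) /
    P.marginalResource x (thresholdPolicy ℓ u ((x : ℝ) : EReal))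

/-- The marginal productivity index extended to `ℝ` by its constant end values. -/
def mpIndexExt : ℝ → ℝ := IccExtend P.lower_lt_upper.le P.mpIndex

/-- First condition: positive marginal resource metrics under all threshold policies. -/
def PCLI1 : Prop :=
  ∀ (x : Icc ℓ u) (z : EReal), 0 < P.marginalResource x (thresholdPolicy ℓ u z)

/-- Second condition: regularity of the marginal productivity index. -/
def PCLI2 : Prop :=
  Monotone P.mpIndex ∧ Continuous P.mpIndex ∧ BddBelow (range P.mpIndex)

/-- Third condition: `F(x, z₂) - F(x, z₁) = ∫_{(z₁, z₂]} m*(z) G(x, dz)`. The threshold function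
`G(x, ·)` is nonincreasing and right-continuous, so the Lebesgue-Stieltjes integral against it is
minus the integral against the Lebesgue-Stieltjes measure of the Stieltjes function `-G(x, ·)`. -/
def PCLI3 : Prop :=
  ∀ x : Icc ℓ u, ∃ S : StieltjesFunction ℝ,
    (∀ z : ℝ, S z = -P.resourceMetric x (thresholdPolicy ℓ u (z : EReal))) ∧
    ∀ z₁ z₂ : ℝ, z₁ < z₂ →
      IntegrableOn P.mpIndexExt (Ioc z₁ z₂) S.measure ∧
      P.rewardMetric x (thresholdPolicy ℓ u (z₂ : EReal)) -
          P.rewardMetric x (thresholdPolicy ℓ u (z₁ : EReal)) =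
        -∫ z in Ioc z₁ z₂, P.mpIndexExt z ∂S.measure

/-- PCL-indexability with respect to threshold policies. -/
def IsPCLIndexable : Prop := P.PCLI1 ∧ P.PCLI2 ∧ P.PCLI3

end RestlessProject

/-! ### The noisy-channel transmission model

The hidden channel state is `1` (good) or `0` (bad), with transition probabilities `p` for `1 → 0`
and `q` for `0 → 1`. The project state is the posterior probability that the channel is good. -/

namespace GilbertElliott

/-- Next belief without observation: `x ↦ q + (1 - p - q) x`. -/
def nextBelief (p q : ℝ) (hp : p ∈ Icc (0 : ℝ) 1) (hq : q ∈ Icc (0 : ℝ) 1) (x : Icc (0 : ℝ) 1) :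
    Icc (0 : ℝ) 1 :=
  ⟨q + (1 - p - q) * x, by
    obtain ⟨x, hx0, hx1⟩ := x
    obtain ⟨hp0, hp1⟩ := hp
    obtain ⟨hq0, hq1⟩ := hq
    constructor <;>
      nlinarith [mul_nonneg hq0 (sub_nonneg.2 hx1), mul_nonneg (sub_nonneg.2 hp1) hx0,
        mul_nonneg hp0 hx0, mul_nonneg (sub_nonneg.2 hq1) (sub_nonneg.2 hx1)]⟩

lemma measurable_nextBelief (p q : ℝ) (hp : p ∈ Icc (0 : ℝ) 1) (hq : q ∈ Icc (0 : ℝ) 1) :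
    Measurable (nextBelief p q hp hq) := by
  unfold nextBelief
  fun_prop

/-- Belief transition when not transmitting: `X_{t+1} = q + ρ x`, where `ρ = 1 - p - q`. -/
def passiveKernel (p q : ℝ) (hp : p ∈ Icc (0 : ℝ) 1) (hq : q ∈ Icc (0 : ℝ) 1) :
    Kernel (Icc (0 : ℝ) 1) (Icc (0 : ℝ) 1) :=
  Kernel.deterministic (nextBelief p q hp hq) (measurable_nextBelief p q hp hq)

/-- Belief transition when transmitting: `X_{t+1}` is `q + ρ` with probability `x` and `q` with
probability `1 - x`. -/
def activeKernel (p q : ℝ) (hp : p ∈ Icc (0 : ℝ) 1) (hq : q ∈ Icc (0 : ℝ) 1) :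
    Kernel (Icc (0 : ℝ) 1) (Icc (0 : ℝ) 1) where
  toFun x := ENNReal.ofReal x • Measure.dirac (nextBelief p q hp hq 1) +
    ENNReal.ofReal (1 - x) • Measure.dirac (nextBelief p q hp hq 0)
  measurable' := by
    refine Measure.measurable_of_measurable_coe _ fun s _ => ?_
    simp only [Measure.add_apply, Measure.smul_apply, smul_eq_mul]
    fun_prop

lemma isMarkovKernel_activeKernel (p q : ℝ) (hp : p ∈ Icc (0 : ℝ) 1) (hq : q ∈ Icc (0 : ℝ) 1) :
    IsMarkovKernel (activeKernel p q hp hq) := by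
  refine ⟨fun x => ⟨?_⟩⟩
  change (ENNReal.ofReal x • Measure.dirac (nextBelief p q hp hq 1) +
    ENNReal.ofReal (1 - x) • Measure.dirac (nextBelief p q hp hq 0) : Measure (Icc (0 : ℝ) 1))
      univ = 1
  simp only [Measure.add_apply, Measure.smul_apply, smul_eq_mul, measure_univ, mul_one]
  rw [← ENNReal.ofReal_add x.2.1 (sub_nonneg.2 x.2.2)]
  simp

/-- The belief-state project with reward `r(x, a) = a x` and resource consumption `c(x, a) = a`. -/
def project (p q β : ℝ) (hp : p ∈ Icc (0 : ℝ) 1) (hq : q ∈ Icc (0 : ℝ) 1)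
    (hβ : β ∈ Ico (0 : ℝ) 1) : RestlessProject 0 1 where
  lower_lt_upper := one_pos
  discount := β
  discount_nonneg := hβ.1
  discount_lt_one := hβ.2
  reward x a := if a then (x : ℝ) else 0
  resource _ a := if a then 1 else 0
  transition a := if a then activeKernel p q hp hq else passiveKernel p q hp hq
  isMarkov a := by
    cases a
    · simp only [Bool.false_eq_true, if_false, passiveKernel]
      infer_instance
    · simpa using isMarkovKernel_activeKernel p q hp hq
  continuous_reward a := by cases a <;> simp <;> fun_prop
  continuous_resource a := continuous_const
  resource_nonneg _ := by simp
  resource_lt _ := by simp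
  weight := by
    have hm : ∀ a : Bool, IsMarkovKernel
        (if a then activeKernel p q hp hq else passiveKernel p q hp hq) := by
      intro a
      cases a
      · simp only [Bool.false_eq_true, if_false, passiveKernel]
        infer_instance
      · simpa using isMarkovKernel_activeKernel p q hp hq
    refine ⟨fun _ => 1, 1, β, measurable_const, fun _ => le_rfl, one_pos, le_rfl, hβ.2,
      fun a x => ⟨?_, ?_, ?_⟩⟩
    · have h0 := x.2.1
      have h1 := x.2.2
      cases a
      · simp
      · simp [abs_of_nonneg h0, h1]
    · have := hm a
      exact integrable_const _
    · have := hm a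
      simp

end GilbertElliott

end

/-! A bounded function `J` evaluates or bounds every policy through its Bellman residual: the
discounted sum of expected residuals along the path telescopes to payoff minus `J x`
(`hasSum_residual`). A vanishing residual evaluates a stationary policy, and a nonpositive one gives
optimality (`optimal_of_bellman`). What remains is one-dimensional analysis of the belief.

The active action leads only to `q + ρ` or `q`, with probabilities linear in `x`, so the value of
being active first is affine in `x`. Under a threshold `z` its two coefficients depend only on how
long the belief waits at `q` before exceeding `z`, that is, on the position of `z` relative to the
orbit of `0` under `x ↦ q + ρ x`. There are three regimes: `z` below some orbit point; `z` above the
orbit but below `q + ρ`; and `z ≥ q + ρ`. Solving for the coefficients gives all metrics in closed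
form (`ThresholdMetrics`). Positivity of the marginal resource is a convexity-type argument along
the orbit (`IsThresholdValue.wait_lt_active`).

In the first regime both marginal metrics at `x = z` are, up to a common denominator, affine
functions plus one supremum of affine functions (`envelope`). This yields continuity, and an
explicit cross-product identity yields strict monotonicity (`strictMonoOn_index`). At the price
`index z` both actions tie at `z`, and the tie breaks in the right direction on either side
(`ThresholdMetrics.marginal_sign`), so the `z`-policy is optimal at that price.

Everything else follows from optimality. Comparing two threshold policies at their two prices shows
that `G` is nonincreasing in the threshold and squeezes the increments of `F` between index
multiples of those of `G`; Riemann sums turn the squeeze into the Stieltjes identity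
(`StieltjesFunction.sub_eq_setIntegral`). The intermediate value theorem supplies a threshold for
each price in `[0, 1]`, and constant policies serve the other prices. -/

namespace RestlessProject

variable {ℓ u : ℝ} (P : RestlessProject ℓ u)

/-! ### Path laws, telescoping of Bellman residuals, and verification. -/

instance (a : Bool) : IsMarkovKernel (P.transition a) := P.isMarkov a

instance (π : ControlPolicy (Icc ℓ u)) : IsMarkovKernel π.first := π.isMarkov_first

instance (π : ControlPolicy (Icc ℓ u)) (n : ℕ) : IsMarkovKernel (π.next n) := π.isMarkov_next n

instance (x : Icc ℓ u) (π : ControlPolicy (Icc ℓ u)) :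
    IsProbabilityMeasure (P.pathMeasure x π) := by
  unfold pathMeasure
  infer_instance

lemma map_eval_zero_pathMeasure (x : Icc ℓ u) (π : ControlPolicy (Icc ℓ u)) :
    (P.pathMeasure x π).map (fun ω => ω 0) = (Measure.dirac x).compProd π.first := by
  have h : (P.pathMeasure x π).map (Preorder.frestrictLe 0) =
      ((Measure.dirac x).compProd π.first).map
        (MeasurableEquiv.piUnique fun _ : Finset.Iic 0 => Icc ℓ u × Bool).symm := by
    rw [pathMeasure, Kernel.trajMeasure, Measure.map_comp _ _ (by fun_prop),
      Kernel.traj_map_frestrictLe, Kernel.partialTraj_self, Measure.id_comp]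
  have h' := congrArg
    (Measure.map (MeasurableEquiv.piUnique fun _ : Finset.Iic 0 => Icc ℓ u × Bool)) h
  rw [Measure.map_map (by fun_prop) (by fun_prop), MeasurableEquiv.map_map_symm] at h'
  exact h'

lemma map_frestrictLe_pathMeasure_compProd (x : Icc ℓ u) (π : ControlPolicy (Icc ℓ u)) (n : ℕ) :
    (P.pathMeasure x π).map (fun ω => (Preorder.frestrictLe n ω, ω (n + 1))) =
      ((P.pathMeasure x π).map (Preorder.frestrictLe n)) ⊗ₘ P.stepKernel π n :=
  (Kernel.map_frestrictLe_trajMeasure_compProd_eq_map_trajMeasure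
    (X := fun _ => Icc ℓ u × Bool)).symm

lemma ae_eval_zero (x : Icc ℓ u) (π : ControlPolicy (Icc ℓ u)) {p : Icc ℓ u × Bool → Prop}
    (hp : MeasurableSet {k | p k}) (h : ∀ᵐ a ∂π.first x, p (x, a)) :
    ∀ᵐ ω ∂P.pathMeasure x π, p (ω 0) := by
  have h' : ∀ᵐ k ∂(P.pathMeasure x π).map (fun ω => ω 0), p k := by
    rw [map_eval_zero_pathMeasure, Measure.ae_compProd_iff hp]
    simpa [ae_dirac_eq] using h
  exact ae_of_ae_map (measurable_pi_apply 0).aemeasurable h'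

lemma ae_eval_succ (x : Icc ℓ u) (π : ControlPolicy (Icc ℓ u)) (n : ℕ)
    {p : Icc ℓ u × Bool → Prop} (hp : MeasurableSet {k | p k})
    (h : ∀ k, ∀ᵐ a ∂π.next n k, p (k.2, a)) :
    ∀ᵐ ω ∂P.pathMeasure x π, p (ω (n + 1)) := by
  have h' : ∀ᵐ k ∂(P.pathMeasure x π).map (fun ω => (Preorder.frestrictLe n ω, ω (n + 1))),
      p k.2 := by
    rw [map_frestrictLe_pathMeasure_compProd, Measure.ae_compProd_iff
      (p := fun k : (Finset.Iic n → Icc ℓ u × Bool) × (Icc ℓ u × Bool) => p k.2)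
      (measurable_snd hp)]
    refine Filter.Eventually.of_forall fun h₀ => ?_
    rw [stepKernel, Kernel.ae_compProd_iff hp]
    exact Filter.Eventually.of_forall fun y => h (h₀, y)
  exact ae_of_ae_map (p := fun k : (Finset.Iic n → Icc ℓ u × Bool) × (Icc ℓ u × Bool) => p k.2)
    (by fun_prop) h'

/-- The one-step Markov property in expectation. Only the state marginal of `stepKernel` enters, and
the action kernel integrates out of it, so the policy affects the right-hand side only through the
path law. -/
lemma integral_eval_succ (x : Icc ℓ u) (π : ControlPolicy (Icc ℓ u)) (n : ℕ)
    {J : Icc ℓ u → ℝ} (hJ : Measurable J) {C : ℝ} (hC : ∀ y, |J y| ≤ C) :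
    ∫ ω, J (ω (n + 1)).1 ∂P.pathMeasure x π =
      ∫ ω, (∫ y, J y ∂P.transition (ω n).2 (ω n).1) ∂P.pathMeasure x π := by
  have hint : ∀ {α : Type} [MeasurableSpace α] (μ : Measure α) [IsFiniteMeasure μ]
      (f : α → Icc ℓ u), Measurable f → Integrable (fun k => J (f k)) μ := fun μ _ f hf =>
    Integrable.of_bound (hJ.comp hf).aestronglyMeasurable C (Filter.Eventually.of_forall
      fun k => hC _)
  have h1 : ∫ ω, J (ω (n + 1)).1 ∂P.pathMeasure x π =
      ∫ k, J k.2.1 ∂(P.pathMeasure x π).map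
        (fun ω => (Preorder.frestrictLe n ω, ω (n + 1))) := by
    rw [integral_map (by fun_prop)]
    exact (hJ.comp (by fun_prop)).aestronglyMeasurable
  have h2 : ∀ h : Finset.Iic n → Icc ℓ u × Bool, ∫ k, J k.1 ∂P.stepKernel π n h =
      ∫ y, J y ∂P.jointTransition (h ⟨n, Finset.mem_Iic.2 le_rfl⟩) := by
    intro h
    have : (P.stepKernel π n h).map Prod.fst =
        P.jointTransition (h ⟨n, Finset.mem_Iic.2 le_rfl⟩) := by
      rw [← Kernel.map_apply _ measurable_fst, ← Kernel.fst_eq, stepKernel, Kernel.fst_compProd,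
        Kernel.comap_apply]
    rw [← this, integral_map (by fun_prop) hJ.aestronglyMeasurable]
  rw [h1, map_frestrictLe_pathMeasure_compProd, Measure.integral_compProd]
  · simp_rw [h2]
    rw [integral_map (by fun_prop)]
    · rfl
    · exact (hJ.stronglyMeasurable.integral_kernel (κ := P.jointTransition.comap
        (fun h : Finset.Iic n → Icc ℓ u × Bool => h ⟨n, Finset.mem_Iic.2 le_rfl⟩)
        (by fun_prop))).aestronglyMeasurable
  · exact hint _ (fun k : (Finset.Iic n → Icc ℓ u × Bool) × (Icc ℓ u × Bool) => k.2.1)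
      (by fun_prop)

lemma integral_eval_zero (x : Icc ℓ u) (π : ControlPolicy (Icc ℓ u)) (J : Icc ℓ u → ℝ) :
    ∫ ω, J (ω 0).1 ∂P.pathMeasure x π = J x := by
  have h : ∀ᵐ ω ∂P.pathMeasure x π, (ω 0).1 = x :=
    P.ae_eval_zero x π (p := fun k => k.1 = x) (measurable_fst (measurableSet_singleton x))
      (Filter.Eventually.of_forall fun _ => rfl)
  rw [integral_congr_ae (g := fun _ => J x) (h.mono fun ω hω => by simp [hω])]
  simp

/-- The expected discounted sum of a one-period payoff `r`. -/
noncomputable def discountedPayoff (r : Icc ℓ u → Bool → ℝ) (x : Icc ℓ u)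
    (π : ControlPolicy (Icc ℓ u)) : ℝ :=
  ∫ ω, ∑' t : ℕ, P.discount ^ t * r (ω t).1 (ω t).2 ∂(P.pathMeasure x π)

/-- The one-period Bellman residual of `J` for the payoff `r`. -/
noncomputable def residual (r : Icc ℓ u → Bool → ℝ) (J : Icc ℓ u → ℝ) (k : Icc ℓ u × Bool) : ℝ :=
  r k.1 k.2 + P.discount * ∫ y, J y ∂P.transition k.2 k.1 - J k.1

lemma measurable_integral_transition {J : Icc ℓ u → ℝ} (hJ : Measurable J) :
    Measurable fun k : Icc ℓ u × Bool => ∫ y, J y ∂P.transition k.2 k.1 :=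
  (hJ.stronglyMeasurable.integral_kernel (κ := P.jointTransition)).measurable

lemma measurable_residual {r : Icc ℓ u → Bool → ℝ} (hr : Measurable (Function.uncurry r))
    {J : Icc ℓ u → ℝ} (hJ : Measurable J) : Measurable (P.residual r J) :=
  (hr.add ((P.measurable_integral_transition hJ).const_mul _)).sub (hJ.comp measurable_fst)

section
variable {r : Icc ℓ u → Bool → ℝ} (hr : Measurable (Function.uncurry r))
  {K : ℝ} (hK : ∀ y a, |r y a| ≤ K)
include hr hK

lemma integrable_payoff (x : Icc ℓ u) (π : ControlPolicy (Icc ℓ u)) (t : ℕ) :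
    Integrable (fun ω => r (ω t).1 (ω t).2) (P.pathMeasure x π) :=
  Integrable.of_bound (hr.comp (measurable_pi_apply t)).aestronglyMeasurable K
    (Filter.Eventually.of_forall fun _ => hK _ _)

lemma hasSum_discountedPayoff (x : Icc ℓ u) (π : ControlPolicy (Icc ℓ u)) :
    HasSum (fun t : ℕ => P.discount ^ t * ∫ ω, r (ω t).1 (ω t).2 ∂P.pathMeasure x π)
      (P.discountedPayoff r x π) := by
  have hβ := P.discount_nonneg
  have := hasSum_integral_of_summable_integral_norm (μ := P.pathMeasure x π)
    (F := fun (t : ℕ) ω => P.discount ^ t * r (ω t).1 (ω t).2)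
    (fun t => (P.integrable_payoff hr hK x π t).const_mul _) ?_
  · simp only [integral_const_mul] at this
    exact this
  · refine Summable.of_nonneg_of_le (fun t => integral_nonneg fun _ => norm_nonneg _) (fun t => ?_)
      ((summable_geometric_of_lt_one hβ P.discount_lt_one).mul_right K)
    refine (integral_mono (g := fun _ => P.discount ^ t * K)
      ((P.integrable_payoff hr hK x π t).const_mul _).norm (integrable_const _)
      fun ω => ?_).trans (by simp)
    simp only [norm_mul, Real.norm_eq_abs, abs_of_nonneg (pow_nonneg hβ t)]
    exact mul_le_mul_of_nonneg_left (hK _ _) (pow_nonneg hβ t)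

/-- By the Markov property the expected residual at time `t` is the expected payoff plus `β j (t +
1) - j t`, with `j t` the expectation of `J` at time `t`. After discounting, the `j` terms telescope
to `-j 0 = -J x`, boundedness of `J` removing the tail. -/
lemma hasSum_residual {J : Icc ℓ u → ℝ} (hJ : Measurable J) {C : ℝ} (hC : ∀ y, |J y| ≤ C)
    (x : Icc ℓ u) (π : ControlPolicy (Icc ℓ u)) :
    HasSum (fun t : ℕ => P.discount ^ t * ∫ ω, P.residual r J (ω t) ∂P.pathMeasure x π)
      (P.discountedPayoff r x π - J x) := by
  have hβ := P.discount_nonneg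
  set j : ℕ → ℝ := fun t => ∫ ω, J (ω t).1 ∂P.pathMeasure x π with hj
  have hjC : ∀ t, |j t| ≤ C := fun t => by
    change ‖∫ ω, J (ω t).1 ∂P.pathMeasure x π‖ ≤ C
    refine (norm_integral_le_of_norm_le_const (C := C)
      (Filter.Eventually.of_forall fun ω => hC _)).trans (le_of_eq ?_)
    rw [probReal_univ, mul_one]
  have hJm : ∀ t, Integrable (fun ω => J (ω t).1) (P.pathMeasure x π) := fun t =>
    Integrable.of_bound (hJ.comp (measurable_fst.comp (measurable_pi_apply t))).aestronglyMeasurable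
      C (Filter.Eventually.of_forall fun _ => hC _)
  have hJi : ∀ t, Integrable (fun ω => ∫ y, J y ∂P.transition (ω t).2 (ω t).1)
      (P.pathMeasure x π) := fun t => by
    refine Integrable.of_bound ((P.measurable_integral_transition hJ).comp
      (measurable_pi_apply t)).aestronglyMeasurable
      C (Filter.Eventually.of_forall fun ω => ?_)
    exact (norm_integral_le_of_norm_le_const (Filter.Eventually.of_forall fun y => hC y)).trans
      (by simp)
  have hres : ∀ t, ∫ ω, P.residual r J (ω t) ∂P.pathMeasure x π =
      ∫ ω, r (ω t).1 (ω t).2 ∂P.pathMeasure x π + P.discount * j (t + 1) - j t := by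
    intro t
    simp only [residual, hj]
    have hadd : Integrable (fun ω => r (ω t).1 (ω t).2 +
        P.discount * ∫ y, J y ∂P.transition (ω t).2 (ω t).1) (P.pathMeasure x π) :=
      (P.integrable_payoff hr hK x π t).add ((hJi t).const_mul _)
    rw [integral_sub hadd (hJm t), integral_add (P.integrable_payoff hr hK x π t)
      ((hJi t).const_mul _), integral_const_mul,
      P.integral_eval_succ x π t hJ hC]
  have hsum : Summable fun t : ℕ => P.discount ^ t * j t := by
    refine Summable.of_norm_bounded
      ((summable_geometric_of_lt_one hβ P.discount_lt_one).mul_right C) fun t => ?_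
    rw [norm_mul, Real.norm_eq_abs, Real.norm_eq_abs, abs_of_nonneg (pow_nonneg hβ t)]
    exact mul_le_mul_of_nonneg_left (hjC t) (pow_nonneg hβ t)
  have htel : HasSum (fun t : ℕ => P.discount ^ (t + 1) * j (t + 1) - P.discount ^ t * j t)
      (- j 0) := by
    have h1 := (hasSum_nat_add_iff' (f := fun t : ℕ => P.discount ^ t * j t) 1).2 hsum.hasSum
    simpa using h1.sub hsum.hasSum
  have hj0 : j 0 = J x := P.integral_eval_zero x π J
  have hterm : (fun t : ℕ => P.discount ^ t * ∫ ω, P.residual r J (ω t) ∂P.pathMeasure x π) =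
      fun t : ℕ => P.discount ^ t * ∫ ω, r (ω t).1 (ω t).2 ∂P.pathMeasure x π +
        (P.discount ^ (t + 1) * j (t + 1) - P.discount ^ t * j t) := by
    funext t
    rw [hres, pow_succ]
    ring
  rw [hterm, sub_eq_add_neg, ← hj0]
  exact (P.hasSum_discountedPayoff hr hK x π).add htel

lemma discountedPayoff_le {J : Icc ℓ u → ℝ} (hJ : Measurable J) {C : ℝ} (hC : ∀ y, |J y| ≤ C)
    (h : ∀ k, P.residual r J k ≤ 0) (x : Icc ℓ u) (π : ControlPolicy (Icc ℓ u)) :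
    P.discountedPayoff r x π ≤ J x := by
  have hterm : ∀ t : ℕ,
      P.discount ^ t * ∫ ω, P.residual r J (ω t) ∂P.pathMeasure x π ≤ 0 := fun t =>
    mul_nonpos_of_nonneg_of_nonpos (pow_nonneg P.discount_nonneg t)
      (integral_nonpos fun ω => h (ω t))
  exact sub_nonpos.1 (hasSum_le hterm (P.hasSum_residual hr hK hJ hC x π) hasSum_zero)

end

lemma ae_regionKernel {B : Set (Icc ℓ u)} (hB : MeasurableSet B) {p : Icc ℓ u × Bool → Prop}
    (h1 : ∀ y ∈ B, p (y, true)) (h0 : ∀ y ∉ B, p (y, false)) (y : Icc ℓ u) :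
    ∀ᵐ a ∂ControlPolicy.regionKernel B hB y, p (y, a) := by
  classical
  rw [ControlPolicy.regionKernel, Kernel.deterministic_apply, ae_dirac_eq]
  by_cases hy : y ∈ B
  · simpa [hy] using h1 y hy
  · simpa [hy] using h0 y hy

section
variable {r : Icc ℓ u → Bool → ℝ} (hr : Measurable (Function.uncurry r))
  {K : ℝ} (hK : ∀ y a, |r y a| ≤ K) {J : Icc ℓ u → ℝ} (hJ : Measurable J) {C : ℝ}
  (hC : ∀ y, |J y| ≤ C) {B : Set (Icc ℓ u)} (hB : MeasurableSet B)
  (h1 : ∀ y ∈ B, P.residual r J (y, true) = 0) (h0 : ∀ y ∉ B, P.residual r J (y, false) = 0)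
include hr hK hJ hC h1 h0

lemma discountedPayoff_ofRegion (x : Icc ℓ u) :
    P.discountedPayoff r x (.ofRegion B hB) = J x := by
  have hm := P.measurable_residual hr hJ
  have h := P.hasSum_residual hr hK hJ hC x (.ofRegion B hB)
  have hae := ae_regionKernel hB (p := fun k => P.residual r J k = 0) h1 h0
  refine sub_eq_zero.1 (h.unique ?_)
  convert hasSum_zero with t
  rw [integral_eq_zero_of_ae, mul_zero]
  cases t with
  | zero =>
    exact P.ae_eval_zero x _ (p := fun k => P.residual r J k = 0)
      (hm (measurableSet_singleton 0)) (hae x)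
  | succ n =>
    exact P.ae_eval_succ x _ n (p := fun k => P.residual r J k = 0)
      (hm (measurableSet_singleton 0)) fun k => hae k.2

/-- From time `1` on the actions follow the region, so all later residuals vanish almost surely;
only the time-`0` residual at `(x, a)` survives in the telescoped sum. -/
lemma discountedPayoff_precede_ofRegion (x : Icc ℓ u) (a : Bool) :
    P.discountedPayoff r x ((ControlPolicy.ofRegion B hB).precede a) =
      r x a + P.discount * ∫ y, J y ∂P.transition a x := by
  have hm := P.measurable_residual hr hJ
  have h := P.hasSum_residual hr hK hJ hC x ((ControlPolicy.ofRegion B hB).precede a)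
  have hae := ae_regionKernel hB (p := fun k => P.residual r J k = 0) h1 h0
  have hzero : ∫ ω, P.residual r J (ω 0)
      ∂P.pathMeasure x ((ControlPolicy.ofRegion B hB).precede a) = P.residual r J (x, a) := by
    have h' : ∀ᵐ ω ∂P.pathMeasure x ((ControlPolicy.ofRegion B hB).precede a), ω 0 = (x, a) :=
      P.ae_eval_zero x _ (p := fun k => k = (x, a)) (measurableSet_singleton _)
        (by simp [ControlPolicy.precede, ae_dirac_eq])
    rw [integral_congr_ae (g := fun _ => P.residual r J (x, a)) (h'.mono fun ω hω => by simp [hω])]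
    simp
  have hsum := hasSum_single (f := fun t : ℕ => P.discount ^ t * ∫ ω, P.residual r J (ω t)
    ∂P.pathMeasure x ((ControlPolicy.ofRegion B hB).precede a)) 0 fun t ht => by
      obtain ⟨n, rfl⟩ := Nat.exists_eq_succ_of_ne_zero ht
      rw [integral_eq_zero_of_ae, mul_zero]
      refine P.ae_eval_succ x _ n (p := fun k => P.residual r J k = 0)
        (hm (measurableSet_singleton 0)) fun k => ?_
      cases n with
      | zero => exact hae k.2
      | succ n => exact hae k.2
  have := h.unique hsum
  rw [pow_zero, one_mul, hzero, residual] at this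
  linarith

end

/-- Verification: a bounded solution of the Bellman inequalities which is attained by a stationary
policy is the optimal value function. -/
lemma optimal_of_bellman {c : ℝ} {J : Icc ℓ u → ℝ} (hJ : Measurable J) {C : ℝ}
    (hC : ∀ y, |J y| ≤ C) {KF KG : ℝ} (hF : Measurable (Function.uncurry P.reward))
    (hG : Measurable (Function.uncurry P.resource))
    (hKF : ∀ y a, |P.reward y a| ≤ KF) (hKG : ∀ y a, |P.resource y a| ≤ KG)
    (h : ∀ k, P.residual (fun y a => P.reward y a - c * P.resource y a) J k ≤ 0)
    {B : Set (Icc ℓ u)} (hB : MeasurableSet B)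
    (h1 : ∀ y ∈ B, P.residual (fun y a => P.reward y a - c * P.resource y a) J (y, true) = 0)
    (h0 : ∀ y ∉ B, P.residual (fun y a => P.reward y a - c * P.resource y a) J (y, false) = 0) :
    (∀ x π, P.netValue c x π ≤ P.netValue c x (.ofRegion B hB)) ∧
      P.IsOptimal c (.ofRegion B hB) ∧ P.optimalValue c = J := by
  have hr : Measurable (Function.uncurry fun y a => P.reward y a - c * P.resource y a) :=
    hF.sub (hG.const_mul c)
  have hK : ∀ y a, |P.reward y a - c * P.resource y a| ≤ KF + |c| * KG := fun y a =>
    (abs_sub _ _).trans (add_le_add (hKF y a)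
      ((abs_mul _ _).le.trans (mul_le_mul_of_nonneg_left (hKG y a) (abs_nonneg c))))
  have hnet : ∀ x π, P.netValue c x π =
      P.discountedPayoff (fun y a => P.reward y a - c * P.resource y a) x π := by
    intro x π
    have h1 := P.hasSum_discountedPayoff hF hKF x π
    have h2 := P.hasSum_discountedPayoff hG hKG x π
    have h3 := P.hasSum_discountedPayoff hr hK x π
    have hterm : ∀ t : ℕ, ∫ ω, (P.reward (ω t).1 (ω t).2 - c * P.resource (ω t).1 (ω t).2)
        ∂P.pathMeasure x π = ∫ ω, P.reward (ω t).1 (ω t).2 ∂P.pathMeasure x π -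
          c * ∫ ω, P.resource (ω t).1 (ω t).2 ∂P.pathMeasure x π := fun t => by
      rw [integral_sub (P.integrable_payoff hF hKF x π t)
        ((P.integrable_payoff hG hKG x π t).const_mul c), integral_const_mul]
    simp only [hterm, mul_sub] at h3
    refine (h1.sub (h2.mul_left c)).unique ?_
    simpa only [mul_left_comm c] using h3
  have hle : ∀ x π, P.netValue c x π ≤ J x := fun x π => by
    rw [hnet]; exact P.discountedPayoff_le hr hK hJ hC h x π
  have heq : ∀ x, P.netValue c x (.ofRegion B hB) = J x := fun x => by
    rw [hnet]; exact P.discountedPayoff_ofRegion hr hK hJ hC hB h1 h0 x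
  have : Nonempty (ControlPolicy (Icc ℓ u)) := ⟨.ofRegion B hB⟩
  have hopt : ∀ x, P.optimalValue c x = J x := fun x =>
    le_antisymm (ciSup_le fun π => hle x π)
      ((heq x).symm.le.trans (le_ciSup (f := fun π => P.netValue c x π)
        ⟨J x, by rintro _ ⟨π, rfl⟩; exact hle x π⟩ _))
  exact ⟨fun x π => (hle x π).trans (heq x).ge, fun x => (heq x).trans (hopt x).symm, funext hopt⟩

end RestlessProject

/-! ### Passive belief dynamics and the orbit of `0`. -/

namespace GilbertElliott

/-- The passive belief update `x ↦ q + ρ x`. -/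
def drift (q ρ x : ℝ) : ℝ := q + ρ * x

/-- The passive belief trajectory started at `0`. -/
def orbit (q ρ : ℝ) (n : ℕ) : ℝ := (drift q ρ)^[n] 0

/-- Admissible parameters: `ρ = 1 - p - q > 0` with `p, q ≥ 0`, and a discount factor. -/
structure Admissible (q ρ β : ℝ) : Prop where
  q_nonneg : 0 ≤ q
  ρ_pos : 0 < ρ
  add_le_one : q + ρ ≤ 1
  β_nonneg : 0 ≤ β
  β_lt_one : β < 1

lemma orbit_zero (q ρ : ℝ) : orbit q ρ 0 = 0 := rfl

lemma orbit_succ (q ρ : ℝ) (n : ℕ) : orbit q ρ (n + 1) = drift q ρ (orbit q ρ n) :=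
  Function.iterate_succ_apply' _ _ _

lemma orbit_one (q ρ : ℝ) : orbit q ρ 1 = q := by simp [orbit, drift]

lemma iterate_drift_orbit (q ρ : ℝ) (k n : ℕ) :
    (drift q ρ)^[k] (orbit q ρ n) = orbit q ρ (k + n) :=
  (Function.iterate_add_apply _ k n 0).symm

lemma iterate_drift_sub (q ρ : ℝ) (k : ℕ) (x y : ℝ) :
    (drift q ρ)^[k] x - (drift q ρ)^[k] y = ρ ^ k * (x - y) := by
  induction k with
  | zero => simp
  | succ k ih =>
    rw [Function.iterate_succ_apply', Function.iterate_succ_apply', pow_succ]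
    simp only [drift]
    linear_combination ρ * ih

namespace Admissible

variable {q ρ β : ℝ} (h : Admissible q ρ β)
include h

lemma ρ_le_one : ρ ≤ 1 := by linarith [h.q_nonneg, h.add_le_one]

lemma add_mem : q + ρ ∈ Icc (0 : ℝ) 1 := ⟨by linarith [h.ρ_pos, h.q_nonneg], h.add_le_one⟩

lemma drift_mem {x : ℝ} (hx : x ∈ Icc (0 : ℝ) 1) : drift q ρ x ∈ Icc q (q + ρ) :=
  ⟨by have := mul_nonneg h.ρ_pos.le hx.1; unfold drift; linarith,
    by have := mul_le_mul_of_nonneg_left hx.2 h.ρ_pos.le; unfold drift; linarith⟩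

lemma drift_mem_unit {x : ℝ} (hx : x ∈ Icc (0 : ℝ) 1) : drift q ρ x ∈ Icc (0 : ℝ) 1 :=
  ⟨h.q_nonneg.trans (h.drift_mem hx).1, (h.drift_mem hx).2.trans h.add_le_one⟩

lemma iterate_mem {x : ℝ} (hx : x ∈ Icc (0 : ℝ) 1) (k : ℕ) :
    (drift q ρ)^[k] x ∈ Icc (0 : ℝ) 1 := by
  induction k with
  | zero => exact hx
  | succ k ih => rw [Function.iterate_succ_apply']; exact h.drift_mem_unit ih

lemma drift_strictMono : StrictMono (drift q ρ) := fun x y hxy => by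
  have := mul_lt_mul_of_pos_left hxy h.ρ_pos
  unfold drift
  linarith

lemma orbit_mem (n : ℕ) : orbit q ρ n ∈ Icc (0 : ℝ) 1 := h.iterate_mem (by simp) n

lemma orbit_succ_le (n : ℕ) : orbit q ρ (n + 1) ≤ q + ρ := by
  rw [orbit_succ]; exact (h.drift_mem (h.orbit_mem n)).2

lemma orbit_le_succ (n : ℕ) : orbit q ρ n ≤ orbit q ρ (n + 1) := by
  induction n with
  | zero => exact (h.orbit_mem 1).1
  | succ n ih =>
    rw [orbit_succ q ρ n, orbit_succ q ρ (n + 1)]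
    exact h.drift_strictMono.monotone ih

lemma orbit_mono : Monotone (orbit q ρ) := monotone_nat_of_le_succ h.orbit_le_succ

lemma orbit_le_iterate {x : ℝ} (hx : 0 ≤ x) (k : ℕ) : orbit q ρ k ≤ (drift q ρ)^[k] x :=
  h.drift_strictMono.monotone.iterate k hx

lemma pow_nonneg (n : ℕ) : 0 ≤ β ^ n := _root_.pow_nonneg h.β_nonneg n

lemma pow_succ_lt_one (n : ℕ) : β ^ (n + 1) < 1 :=
  pow_lt_one₀ h.β_nonneg h.β_lt_one n.succ_ne_zero

lemma pow_succ_le (n : ℕ) : β ^ (n + 1) ≤ β := by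
  simpa using pow_le_pow_of_le_one h.β_nonneg h.β_lt_one.le (Nat.le_add_left 1 n)

lemma one_sub_pos : 0 < 1 - β * (q + ρ) := by
  nlinarith [h.β_nonneg, h.β_lt_one, h.add_le_one, h.add_mem.1]

lemma one_sub_mul_pos : 0 < 1 - β * ρ := by
  nlinarith [h.β_nonneg, h.β_lt_one, h.ρ_le_one, h.ρ_pos]

lemma bddAbove_orbit : BddAbove (range (orbit q ρ)) :=
  ⟨1, by rintro _ ⟨n, rfl⟩; exact (h.orbit_mem n).2⟩

/-- Working with the supremum of the orbit instead of `q / (1 - ρ)` covers `ρ = 1` without a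
separate case. -/
lemma drift_iSup : drift q ρ (⨆ n, orbit q ρ n) = ⨆ n, orbit q ρ n := by
  have h1 := tendsto_atTop_ciSup h.orbit_mono h.bddAbove_orbit
  have h2 : Filter.Tendsto (fun n => orbit q ρ (n + 1)) Filter.atTop
      (nhds (drift q ρ (⨆ n, orbit q ρ n))) := by
    simp only [orbit_succ, drift]
    exact (h1.const_mul ρ).const_add q
  exact tendsto_nhds_unique h2 (h1.comp (Filter.tendsto_add_atTop_nat 1))

lemma drift_le_self_of_le {x z : ℝ} (hz : drift q ρ z ≤ z) (hzx : z ≤ x) : drift q ρ x ≤ x := by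
  have := mul_le_mul_of_nonneg_right h.ρ_le_one (sub_nonneg.2 hzx)
  unfold drift at *
  linarith

/-- Since `ρ ≤ 1`, the displacement `drift x - x` is nonincreasing in `x`, and it is zero at the
supremum of the orbit. A threshold above the orbit is therefore never crossed from below. -/
lemma drift_le_self {z : ℝ} (hz : ∀ n, orbit q ρ n ≤ z) : drift q ρ z ≤ z :=
  h.drift_le_self_of_le h.drift_iSup.le (ciSup_le hz)

end Admissible

/-- `z` lies strictly below the `(n+1)`-st point of the orbit of `0`, and at or above the earlier
positive-time ones. -/
structure Below (q ρ : ℝ) (n : ℕ) (z : ℝ) : Prop where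
  lt : z < orbit q ρ (n + 1)
  le : ∀ j < n, orbit q ρ (j + 1) ≤ z

lemma exists_below_or (q ρ z : ℝ) :
    (∃ n, Below q ρ n z) ∨ ∀ n, orbit q ρ (n + 1) ≤ z := by
  classical
  by_cases hz : ∃ n, z < orbit q ρ (n + 1)
  · exact .inl ⟨Nat.find hz, Nat.find_spec hz, fun j hj => not_lt.1 (Nat.find_min hz hj)⟩
  · exact .inr fun n => not_lt.1 fun hn => hz ⟨n, hn⟩

lemma Below.orbit_le {q ρ z : ℝ} {n : ℕ} (hz : Below q ρ n z) (h0 : 0 ≤ z) : orbit q ρ n ≤ z := by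
  cases n with
  | zero => exact h0
  | succ n => exact hz.le n n.lt_succ_self

/-! ### Values of threshold policies as truncated waiting problems. -/

/-- `J` is the discounted value of the `z`-policy for the payoff `a (r₁ x + r₀)`, and `A x` is the
value of being active at `x` first. -/
structure IsThresholdValue (q ρ β z r₁ r₀ : ℝ) (J A : ℝ → ℝ) : Prop where
  measurable : Measurable J
  bounded : ∃ C, ∀ x ∈ Icc (0 : ℝ) 1, |J x| ≤ C
  active : ∀ x ∈ Icc (0 : ℝ) 1, z < x → J x = A x
  passive : ∀ x ∈ Icc (0 : ℝ) 1, x ≤ z → J x = β * J (drift q ρ x)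
  first : ∀ x, A x = r₁ * x + r₀ + β * (x * J (q + ρ) + (1 - x) * J q)

lemma IsThresholdValue.sub_mul {q ρ β z : ℝ} {J A J' A' : ℝ → ℝ}
    (hJ : IsThresholdValue q ρ β z 1 0 J A) (hJ' : IsThresholdValue q ρ β z 0 1 J' A') (c : ℝ) :
    IsThresholdValue q ρ β z 1 (-c) (fun x => J x - c * J' x) (fun x => A x - c * A' x) where
  measurable := hJ.measurable.sub (hJ'.measurable.const_mul c)
  bounded := by
    obtain ⟨C, hC⟩ := hJ.bounded
    obtain ⟨C', hC'⟩ := hJ'.bounded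
    exact ⟨C + |c| * C', fun x hx => (abs_sub _ _).trans (add_le_add (hC x hx)
      ((abs_mul _ _).le.trans (mul_le_mul_of_nonneg_left (hC' x hx) (abs_nonneg c))))⟩
  active x hx hz := by rw [hJ.active x hx hz, hJ'.active x hx hz]
  passive x hx hz := by rw [hJ.passive x hx hz, hJ'.passive x hx hz]; ring
  first x := by rw [hJ.first x, hJ'.first x]; ring

/-- Passive for at most `k - 1` periods until the belief exceeds `z`, then worth `A`; worthless if
the belief does not exceed `z` in that time. -/
noncomputable def waitValue (q ρ β z : ℝ) (A : ℝ → ℝ) : ℕ → ℝ → ℝ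
  | 0, _ => 0
  | k + 1, x => if z < x then A x else β * waitValue q ρ β z A k (drift q ρ x)

section waitValue

variable {q ρ β z : ℝ} {A : ℝ → ℝ}

lemma waitValue_of_lt {x : ℝ} (hx : z < x) (k : ℕ) : waitValue q ρ β z A (k + 1) x = A x := by
  simp [waitValue, hx]

lemma waitValue_of_le {x : ℝ} (hx : x ≤ z) (k : ℕ) :
    waitValue q ρ β z A (k + 1) x = β * waitValue q ρ β z A k (drift q ρ x) := by
  simp [waitValue, hx.not_gt]

lemma measurable_waitValue (hA : Measurable A) (k : ℕ) :
    Measurable (waitValue q ρ β z A k) := by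
  induction k with
  | zero => exact measurable_const
  | succ k ih =>
    refine Measurable.ite measurableSet_Ioi hA ((ih.comp ?_).const_mul β)
    unfold drift
    fun_prop

lemma waitValue_succ_of_hit (k : ℕ) :
    ∀ x, z < (drift q ρ)^[k] x → waitValue q ρ β z A (k + 2) x = waitValue q ρ β z A (k + 1) x := by
  induction k with
  | zero =>
    intro x hx
    have hx' : z < x := hx
    rw [waitValue_of_lt hx', waitValue_of_lt hx']
  | succ k ih =>
    intro x hx
    rcases lt_or_ge z x with hz | hz
    · rw [waitValue_of_lt hz, waitValue_of_lt hz]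
    · rw [waitValue_of_le hz, waitValue_of_le hz, ih _ (by rwa [← Function.iterate_succ_apply])]

/-- Used from `orbit 1 = q`: this evaluates the threshold value at the belief reached after an
unsuccessful transmission. -/
lemma waitValue_add_orbit (k n : ℕ) (m : ℕ) (hn : ∀ j < n, orbit q ρ (m + j) ≤ z) :
    waitValue q ρ β z A (k + n) (orbit q ρ m) =
      β ^ n * waitValue q ρ β z A k (orbit q ρ (m + n)) := by
  induction n generalizing m with
  | zero => simp
  | succ n ih =>
    have h0 : orbit q ρ m ≤ z := hn 0 n.succ_pos
    rw [← add_assoc, waitValue_of_le h0, ← orbit_succ, ih (m + 1)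
      (fun j hj => by simpa [add_assoc, add_comm 1] using hn (j + 1) (by omega))]
    rw [pow_succ, show m + 1 + n = m + (n + 1) by ring]
    ring

lemma exists_bound_waitValue (h : Admissible q ρ β) {C : ℝ} (hA : ∀ x ∈ Icc (0 : ℝ) 1, |A x| ≤ C)
    (k : ℕ) : ∀ x ∈ Icc (0 : ℝ) 1, |waitValue q ρ β z A k x| ≤ C := by
  have hC : 0 ≤ C := (abs_nonneg _).trans (hA 0 (by simp))
  induction k with
  | zero => intro x _; simpa [waitValue] using hC
  | succ k ih =>
    intro x hx
    rcases lt_or_ge z x with hz | hz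
    · rw [waitValue_of_lt hz]; exact hA x hx
    · rw [waitValue_of_le hz, abs_mul, abs_of_nonneg h.β_nonneg]
      exact (mul_le_mul_of_nonneg_left (ih _ (h.drift_mem_unit hx)) h.β_nonneg).trans
        (mul_le_of_le_one_left hC h.β_lt_one.le)

/-- Finitely many comparisons are made: `z < x` survives a small increase of `z`, and `x ≤ z`
survives any increase. This is the source of right-continuity in the threshold; the horizon `k` and
the active value `A` must stay fixed. -/
lemma eventually_waitValue_eq (k : ℕ) (x : ℝ) :
    ∀ᶠ z' in nhdsWithin z (Ici z), waitValue q ρ β z' A k x = waitValue q ρ β z A k x := by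
  induction k generalizing x with
  | zero => exact .of_forall fun _ => rfl
  | succ k ih =>
    rcases lt_or_ge z x with hz | hz
    · filter_upwards [nhdsWithin_le_nhds (Iio_mem_nhds hz)] with z' hz'
      rw [waitValue_of_lt hz, waitValue_of_lt hz']
    · filter_upwards [ih (drift q ρ x), self_mem_nhdsWithin] with z' hz' hzz'
      rw [waitValue_of_le hz, waitValue_of_le (hz.trans hzz'), hz']

end waitValue

section existence

variable {q ρ β z r₁ r₀ a b : ℝ}

lemma exists_bound_affine (a b : ℝ) : ∀ x ∈ Icc (0 : ℝ) 1, |a + b * x| ≤ |a| + |b| := fun x hx =>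
  (abs_add_le _ _).trans (add_le_add le_rfl (by
    rw [abs_mul, abs_of_nonneg hx.1]; exact mul_le_of_le_one_right (abs_nonneg b) hx.2))

/-- The hypothesis `hA` is the linear system for `a` and `b`: here `q + ρ` lies above `z`, and from
`q` the belief first exceeds `z` after `n` passive periods, at `orbit (n + 1)`. -/
lemma isThresholdValue_of_below (h : Admissible q ρ β) {n : ℕ} (hz : Below q ρ n z)
    (hA : ∀ x, a + b * x = r₁ * x + r₀ + β * (x * (a + b * (q + ρ)) +
      (1 - x) * (β ^ n * (a + b * orbit q ρ (n + 1))))) :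
    IsThresholdValue q ρ β z r₁ r₀ (waitValue q ρ β z (fun x => a + b * x) (n + 2))
      (fun x => a + b * x) where
  measurable := measurable_waitValue (by fun_prop) _
  bounded := ⟨_, exists_bound_waitValue h (exists_bound_affine a b) _⟩
  active x _ hx := waitValue_of_lt hx _
  passive x hx hxz := by
    rw [waitValue_of_le hxz]
    congr 1
    -- Any `x ≥ 0` exceeds `z` after at most `n + 1` drifts, since it dominates the orbit of `0`.
    -- Hence the horizon `n + 2` is long enough, and truncation loses nothing.
    refine (waitValue_succ_of_hit n _ ?_).symm
    rw [← Function.iterate_succ_apply]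
    exact hz.lt.trans_le (h.orbit_le_iterate hx.1 _)
  first x := by
    have h1 : waitValue q ρ β z (fun x => a + b * x) (n + 2) (q + ρ) = a + b * (q + ρ) :=
      waitValue_of_lt (hz.lt.trans_le (h.orbit_succ_le n)) _
    have h2 : waitValue q ρ β z (fun x => a + b * x) (n + 2) q =
        β ^ n * (a + b * orbit q ρ (n + 1)) := by
      have := waitValue_add_orbit (q := q) (ρ := ρ) (β := β) (z := z) (A := fun x => a + b * x)
        2 n 1 (fun j hj => by simpa [add_comm] using hz.le j hj)
      rw [orbit_one, add_comm 2 n, add_comm 1 n, waitValue_of_lt hz.lt] at this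
      exact this
    rw [h1, h2]
    exact hA x

/-- Once at or below `z` the belief stays there, so the value is zero on that side and horizon `1`
suffices. In particular `J q = 0`, and only `q + ρ` can contribute to the active value. -/
lemma isThresholdValue_of_drift_le (h : Admissible q ρ β) (hz : drift q ρ z ≤ z) (hqz : q ≤ z)
    (hA : ∀ x, a + b * x = r₁ * x + r₀ + β * (x * if z < q + ρ then a + b * (q + ρ) else 0)) :
    IsThresholdValue q ρ β z r₁ r₀ (waitValue q ρ β z (fun x => a + b * x) 1)
      (fun x => a + b * x) where
  measurable := measurable_waitValue (by fun_prop) _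
  bounded := ⟨_, exists_bound_waitValue h (exists_bound_affine a b) _⟩
  active x _ hx := waitValue_of_lt hx _
  passive x hx hxz := by
    rw [waitValue_of_le hxz, waitValue_of_le ((h.drift_strictMono.monotone hxz).trans hz)]
    simp [waitValue]
  first x := by
    rw [waitValue_of_le hqz, hA x]
    simp [waitValue]

end existence

end GilbertElliott

/-! ### Being active first beats waiting. -/

namespace GilbertElliott

section positivity

variable {q ρ β z r₁ r₀ a b : ℝ} {J : ℝ → ℝ} {A : ℝ → ℝ}

lemma IsThresholdValue.eq_of_hit (h : Admissible q ρ β) (hJ : IsThresholdValue q ρ β z r₁ r₀ J A)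
    (k : ℕ) : ∀ x ∈ Icc (0 : ℝ) 1, (∀ j < k, (drift q ρ)^[j] x ≤ z) → z < (drift q ρ)^[k] x →
      J x = β ^ k * A ((drift q ρ)^[k] x) := by
  induction k with
  | zero => intro x hx _ hz; simpa using hJ.active x hx hz
  | succ k ih =>
    intro x hx hle hlt
    rw [hJ.passive x hx (hle 0 k.succ_pos), ih _ (h.drift_mem_unit hx)
      (fun j hj => by rw [← Function.iterate_succ_apply]; exact hle (j + 1) (by omega))
      (by rwa [← Function.iterate_succ_apply]), ← Function.iterate_succ_apply, pow_succ]
    ring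

/-- The gain `y ↦ (a + b y) - β (a + b drift y)` is nondecreasing with slope `b (1 - β ρ)`. If it is
nonnegative at a point that drifts upwards, it stays so along the trajectory, and the discounted
values decrease. -/
lemma affine_discount_iterate_le (h : Admissible q ρ β) (hb : 0 ≤ b) (k : ℕ) :
    ∀ x, x ≤ drift q ρ x → β * (a + b * drift q ρ x) ≤ a + b * x →
      β ^ k * (a + b * (drift q ρ)^[k] x) ≤ a + b * x := by
  induction k with
  | zero => intro x _ _; simp
  | succ k ih =>
    intro x hx hd
    have h1 := ih (drift q ρ x) (h.drift_strictMono.monotone hx) (by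
      have := mul_nonneg (mul_nonneg hb h.one_sub_mul_pos.le) (sub_nonneg.2 hx)
      unfold drift at *
      linarith)
    rw [Function.iterate_succ_apply, pow_succ]
    have := mul_le_mul_of_nonneg_left h1 h.β_nonneg
    linarith

/-- The mirror image: a nonpositive gain at `x` is nonpositive at all lower points, so discounted
values increase along the orbit of `0` while it stays at or below `x`. -/
lemma affine_zero_le_orbit (h : Admissible q ρ β) (hb : 0 ≤ b) {x : ℝ}
    (hd : a + b * x ≤ β * (a + b * drift q ρ x)) (j : ℕ) (hj : orbit q ρ j ≤ x) :
    a ≤ β ^ j * (a + b * orbit q ρ j) := by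
  induction j with
  | zero => simp [orbit_zero]
  | succ j ih =>
    have hjx := (h.orbit_le_succ j).trans hj
    have h1 := ih hjx
    have h2 : a + b * orbit q ρ j ≤ β * (a + b * orbit q ρ (j + 1)) := by
      have := mul_nonneg (mul_nonneg hb h.one_sub_mul_pos.le) (sub_nonneg.2 hjx)
      rw [orbit_succ]
      unfold drift at *
      linarith
    calc a ≤ β ^ j * (a + b * orbit q ρ j) := h1
      _ ≤ β ^ j * (β * (a + b * orbit q ρ (j + 1))) :=
        mul_le_mul_of_nonneg_left h2 (h.pow_nonneg j)
      _ = _ := by ring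

/-- Being active beats waiting once, for an increasing affine active value. -/
lemma IsThresholdValue.wait_lt_active (h : Admissible q ρ β) {n : ℕ} (hz : Below q ρ n z)
    (hJ : IsThresholdValue q ρ β z r₁ r₀ J (fun x => a + b * x)) (hb : 0 ≤ b) (ha : 0 < a)
    (h1 : n ≠ 0 → β ^ n * (a + b * orbit q ρ n) < a)
    (h2 : β ^ (n + 1) * (a + b * orbit q ρ (n + 1)) < a) {x : ℝ} (hx : x ∈ Icc (0 : ℝ) 1) :
    β * J (drift q ρ x) < a + b * x := by
  classical
  have hex : ∃ i, z < (drift q ρ)^[i] (drift q ρ x) :=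
    ⟨n, by rw [← Function.iterate_succ_apply]; exact hz.lt.trans_le (h.orbit_le_iterate hx.1 _)⟩
  obtain ⟨i, hi, hmin⟩ : ∃ i, z < (drift q ρ)^[i] (drift q ρ x) ∧
      ∀ j < i, (drift q ρ)^[j] (drift q ρ x) ≤ z :=
    ⟨Nat.find hex, Nat.find_spec hex, fun j hj => not_lt.1 (Nat.find_min hex hj)⟩
  have hin : i ≤ n := by
    by_contra! hlt
    refine absurd (hmin n hlt) (not_le.2 ?_)
    rw [← Function.iterate_succ_apply]
    exact hz.lt.trans_le (h.orbit_le_iterate hx.1 _)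
  rw [hJ.eq_of_hit h i _ (h.drift_mem_unit hx) hmin hi, ← mul_assoc, ← pow_succ',
    ← Function.iterate_succ_apply]
  rw [← Function.iterate_succ_apply] at hi
  have hax : 0 < a + b * x := add_pos_of_pos_of_nonneg ha (mul_nonneg hb hx.1)
  -- If the belief drifts down, waiting lowers the active value and discounts it. If it drifts up,
  -- the failure of the claim is carried over from `x` to the orbit of `0`, where it contradicts
  -- `h1` or `h2`.
  rcases le_or_gt (drift q ρ x) x with hdx | hdx
  · have hle : (drift q ρ)^[i + 1] x ≤ x := by
      have : ∀ k, (drift q ρ)^[k] x ≤ x := fun k => by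
        induction k with
        | zero => exact le_rfl
        | succ k ih =>
          rw [Function.iterate_succ_apply']
          exact (h.drift_strictMono.monotone ih).trans hdx
      exact this _
    calc β ^ (i + 1) * (a + b * (drift q ρ)^[i + 1] x) ≤ β ^ (i + 1) * (a + b * x) :=
          mul_le_mul_of_nonneg_left (by gcongr) (h.pow_nonneg _)
      _ < a + b * x := mul_lt_of_lt_one_left hax (h.pow_succ_lt_one i)
  · by_contra! hcon
    -- Were the one-step gain positive at `x`, discounted values would decrease along the whole
    -- upward trajectory, and waiting `i + 1` periods could not pay.
    have hd : a + b * x ≤ β * (a + b * drift q ρ x) := by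
      by_contra! hpos
      have h3 := affine_discount_iterate_le (a := a) h hb i (drift q ρ x)
        (h.drift_strictMono.monotone hdx.le) (by
          have := mul_nonneg (mul_nonneg hb h.one_sub_mul_pos.le) (sub_nonneg.2 hdx.le)
          unfold drift at *
          linarith)
      rw [Function.iterate_succ_apply, pow_succ'] at hcon
      have := mul_le_mul_of_nonneg_left h3 h.β_nonneg
      linarith
    have key : ∀ j, orbit q ρ j ≤ x → a ≤ β ^ (i + 1 + j) * (a + b * orbit q ρ (i + 1 + j)) := by
      intro j hj
      have h3 := affine_zero_le_orbit h hb hd j hj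
      -- Moving the start down from `x` to `orbit j` lowers the left side of `hcon` by `b (x - orbit
      -- j)` and the right side by only `(β ρ) ^ (i + 1)` times that.
      have h4 : a + b * orbit q ρ j ≤ β ^ (i + 1) * (a + b * orbit q ρ (i + 1 + j)) := by
        have h5 := iterate_drift_sub q ρ (i + 1) x (orbit q ρ j)
        rw [iterate_drift_orbit] at h5
        have h6 : β ^ (i + 1) * ρ ^ (i + 1) ≤ 1 := by
          rw [← mul_pow]
          exact pow_le_one₀ (mul_nonneg h.β_nonneg h.ρ_pos.le) (by linarith [h.one_sub_mul_pos])
        have h7 := mul_nonneg (mul_nonneg hb (sub_nonneg.2 hj)) (sub_nonneg.2 h6)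
        linear_combination hcon + h7 + β ^ (i + 1) * b * h5
      calc a ≤ β ^ j * (a + b * orbit q ρ j) := h3
        _ ≤ β ^ j * (β ^ (i + 1) * (a + b * orbit q ρ (i + 1 + j))) :=
          mul_le_mul_of_nonneg_left h4 (h.pow_nonneg j)
        _ = _ := by ring
    -- The index `j` is chosen so that `i + 1 + j` is `n + 1` in the first case and `n` in the
    -- second. In the latter, `orbit n ≤ z` lies below the hitting point of `x`, which forces `orbit
    -- j ≤ x`.
    rcases hin.eq_or_lt with rfl | hlt
    · exact absurd (key 0 hx.1) (not_le.2 h2)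
    · refine absurd (key (n - (i + 1)) ?_) ?_
      · refine ((h.drift_strictMono.iterate (i + 1)).lt_iff_lt.1 ?_).le
        rw [iterate_drift_orbit, Nat.add_sub_cancel' hlt]
        refine lt_of_le_of_lt ?_ hi
        have := hz.le (n - 1) (by omega)
        rwa [Nat.sub_add_cancel (by omega)] at this
      · rw [Nat.add_sub_cancel' hlt]
        exact not_le.2 (h1 (by omega))

end positivity

/-! ### Closed forms when the threshold lies below some orbit point. -/

section closedForm

variable {q ρ β z : ℝ}

/-- Common denominator of the threshold metrics; `t = β ^ (n + 1)` and `y` is the first orbit point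
above the threshold. -/
def metricDenom (q ρ β t y : ℝ) : ℝ := (1 - β * (q + ρ)) * (1 - t) + (1 - β) * (t * y)

lemma Admissible.metricDenom_pos (h : Admissible q ρ β) {t y : ℝ} (ht0 : 0 ≤ t) (ht1 : t < 1)
    (hy : 0 ≤ y) : 0 < metricDenom q ρ β t y :=
  add_pos_of_pos_of_nonneg (mul_pos h.one_sub_pos (sub_pos.2 ht1))
    (mul_nonneg (sub_pos.2 h.β_lt_one).le (mul_nonneg ht0 hy))

/-- Coefficients of the active reward value. -/
noncomputable def rewardCoeff (q ρ β t y : ℝ) : ℝ × ℝ :=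
  (t * y / metricDenom q ρ β t y, (1 - t) / metricDenom q ρ β t y)

/-- Coefficients of the active resource value. -/
noncomputable def resourceCoeff (q ρ β t y : ℝ) : ℝ × ℝ :=
  ((1 - β * (q + ρ) + t * y) / metricDenom q ρ β t y, (β - t) / metricDenom q ρ β t y)

lemma isThresholdValue_reward_below (h : Admissible q ρ β) {n : ℕ} (hz : Below q ρ n z) :
    IsThresholdValue q ρ β z 1 0
      (waitValue q ρ β z (fun x => (rewardCoeff q ρ β (β ^ (n + 1)) (orbit q ρ (n + 1))).1 +
        (rewardCoeff q ρ β (β ^ (n + 1)) (orbit q ρ (n + 1))).2 * x) (n + 2))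
      (fun x => (rewardCoeff q ρ β (β ^ (n + 1)) (orbit q ρ (n + 1))).1 +
        (rewardCoeff q ρ β (β ^ (n + 1)) (orbit q ρ (n + 1))).2 * x) := by
  refine isThresholdValue_of_below h hz fun x => ?_
  have hD := (h.metricDenom_pos (h.pow_nonneg (n + 1)) (h.pow_succ_lt_one n)
    (h.orbit_mem (n + 1)).1).ne'
  simp only [rewardCoeff]
  field_simp
  simp only [metricDenom, pow_succ]
  ring

lemma isThresholdValue_resource_below (h : Admissible q ρ β) {n : ℕ} (hz : Below q ρ n z) :
    IsThresholdValue q ρ β z 0 1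
      (waitValue q ρ β z (fun x => (resourceCoeff q ρ β (β ^ (n + 1)) (orbit q ρ (n + 1))).1 +
        (resourceCoeff q ρ β (β ^ (n + 1)) (orbit q ρ (n + 1))).2 * x) (n + 2))
      (fun x => (resourceCoeff q ρ β (β ^ (n + 1)) (orbit q ρ (n + 1))).1 +
        (resourceCoeff q ρ β (β ^ (n + 1)) (orbit q ρ (n + 1))).2 * x) := by
  refine isThresholdValue_of_below h hz fun x => ?_
  have hD := (h.metricDenom_pos (h.pow_nonneg (n + 1)) (h.pow_succ_lt_one n)
    (h.orbit_mem (n + 1)).1).ne'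
  simp only [resourceCoeff]
  field_simp
  simp only [metricDenom, pow_succ]
  ring

end closedForm

end GilbertElliott

/-! ### The index: closed form, continuity, strict monotonicity. -/

namespace GilbertElliott

section index

variable (q ρ β : ℝ)

/-- The passive belief limit. -/
noncomputable def beliefLimit : ℝ := ⨆ n, orbit q ρ n

/-- The affine pieces of the convex function `envelope`. -/
noncomputable def tangent (n : ℕ) (x : ℝ) : ℝ :=
  β ^ (n + 1) * ((1 - β) * orbit q ρ (n + 1) - (x - β * drift q ρ x))

/-- A convex piecewise affine function, with nodes on the orbit of `0`. -/
noncomputable def envelope (x : ℝ) : ℝ := ⨆ n, tangent q ρ β n x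

/-- Numerator of the index below the passive belief limit. -/
noncomputable def indexNum (x : ℝ) : ℝ := x - β * drift q ρ x + envelope q ρ β x

/-- Denominator of the index below the passive belief limit. -/
noncomputable def indexDen (x : ℝ) : ℝ :=
  β * (x - β * drift q ρ x) + (1 - β) * (1 - β * (q + ρ)) + envelope q ρ β x

open Classical in
/-- Closed form of the marginal productivity index. -/
noncomputable def index (x : ℝ) : ℝ :=
  if x ≤ beliefLimit q ρ then indexNum q ρ β x / indexDen q ρ β x
  else if x ≤ q + ρ then x / (1 - β * (q + ρ) + β * x) else x

end index

section

variable {q ρ β : ℝ}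

namespace Admissible

variable (h : Admissible q ρ β)
include h

lemma orbit_le_beliefLimit (n : ℕ) : orbit q ρ n ≤ beliefLimit q ρ :=
  le_ciSup h.bddAbove_orbit n

lemma beliefLimit_le : beliefLimit q ρ ≤ q + ρ :=
  ciSup_le fun n => (h.orbit_le_succ n).trans (h.orbit_succ_le n)

lemma beliefLimit_nonneg : 0 ≤ beliefLimit q ρ := h.orbit_le_beliefLimit 0

lemma bddAbove_tangent (x : ℝ) : BddAbove (range fun n => tangent q ρ β n x) := by
  refine ⟨1 + |x - β * drift q ρ x|, ?_⟩
  rintro _ ⟨n, rfl⟩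
  have h1 := h.orbit_mem (n + 1)
  have h2 : (1 - β) * orbit q ρ (n + 1) - (x - β * drift q ρ x) ≤ 1 + |x - β * drift q ρ x| := by
    have := mul_le_one₀ (by linarith [h.β_nonneg] : 1 - β ≤ 1) h1.1 h1.2
    linarith [neg_abs_le (x - β * drift q ρ x)]
  have h3 := abs_nonneg (x - β * drift q ρ x)
  exact (mul_le_mul_of_nonneg_left h2 (h.pow_nonneg _)).trans
    (mul_le_of_le_one_left (by linarith) (h.pow_succ_lt_one n).le)

lemma tangent_le_envelope (n : ℕ) (x : ℝ) : tangent q ρ β n x ≤ envelope q ρ β x :=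
  le_ciSup (h.bddAbove_tangent x) n

/-- All tangents have slopes between `-1` and `0`, so their supremum is 1-Lipschitz. This avoids
gluing infinitely many pieces at nodes that accumulate at `beliefLimit`. -/
lemma continuous_envelope : Continuous (envelope q ρ β) := by
  refine (LipschitzWith.of_le_add_mul 1 fun x y => ciSup_le fun n => ?_).continuous
  have h1 : tangent q ρ β n x = tangent q ρ β n y + β ^ (n + 1) * (1 - β * ρ) * (y - x) := by
    simp only [tangent, drift]
    ring
  have h2 : β ^ (n + 1) * (1 - β * ρ) ≤ 1 :=
    mul_le_one₀ (h.pow_succ_lt_one n).le h.one_sub_mul_pos.le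
      (by linarith [mul_nonneg h.β_nonneg h.ρ_pos.le])
  have h3 : β ^ (n + 1) * (1 - β * ρ) * (y - x) ≤ dist x y := by
    rw [dist_comm, Real.dist_eq]
    exact (mul_le_mul_of_nonneg_left (le_abs_self _)
      (mul_nonneg (h.pow_nonneg _) h.one_sub_mul_pos.le)).trans
      (mul_le_of_le_one_left (abs_nonneg _) h2)
  have h4 := h.tangent_le_envelope n y
  change _ ≤ envelope q ρ β y + _
  rw [h1, NNReal.coe_one, one_mul]
  linarith

omit h in
-- Consecutive tangents cross exactly at the node `orbit (n + 1)`. Hence at a given `x` the sequence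
-- of tangents rises up to the index `n` with `Below q ρ n x` and falls afterwards.
lemma tangent_succ_sub (n : ℕ) (x : ℝ) : tangent q ρ β (n + 1) x - tangent q ρ β n x =
    β ^ (n + 1) * (1 - β) * (1 - β * ρ) * (x - orbit q ρ (n + 1)) := by
  simp only [tangent, orbit_succ q ρ (n + 1), drift, pow_succ]
  ring

lemma tangent_le_of_below {n : ℕ} {x : ℝ} (hx : Below q ρ n x) (m : ℕ) :
    tangent q ρ β m x ≤ tangent q ρ β n x := by
  have hc : ∀ k, 0 ≤ β ^ (k + 1) * (1 - β) * (1 - β * ρ) := fun k =>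
    mul_nonneg (mul_nonneg (h.pow_nonneg _) (sub_nonneg.2 h.β_lt_one.le)) h.one_sub_mul_pos.le
  rcases le_total m n with hmn | hnm
  · have : ∀ k, m ≤ k → k ≤ n → tangent q ρ β m x ≤ tangent q ρ β k x := by
      intro k hk
      induction k, hk using Nat.le_induction with
      | base => exact fun _ => le_rfl
      | succ k _ ih =>
        intro hkn
        have h1 := tangent_succ_sub (q := q) (ρ := ρ) (β := β) k x
        have h2 := mul_nonneg (hc k) (sub_nonneg.2 (hx.le k hkn))
        linarith [ih (by omega)]
    exact this n hmn le_rfl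
  · induction m, hnm using Nat.le_induction with
    | base => exact le_rfl
    | succ k hk ih =>
      have h1 := tangent_succ_sub (q := q) (ρ := ρ) (β := β) k x
      have h2 := mul_nonneg (hc k) (sub_nonneg.2
        (hx.lt.le.trans (h.orbit_mono (Nat.succ_le_succ hk))))
      linarith

lemma envelope_of_below {n : ℕ} {x : ℝ} (hx : Below q ρ n x) :
    envelope q ρ β x = tangent q ρ β n x :=
  le_antisymm (ciSup_le (h.tangent_le_of_below hx)) (h.tangent_le_envelope n x)

lemma drift_beliefLimit : drift q ρ (beliefLimit q ρ) = beliefLimit q ρ := h.drift_iSup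

/-- At the fixed point of the drift every tangent is nonpositive, and they tend to `0` because of
the factor `β ^ (n + 1)`. The vanishing of the envelope here is what makes the first two formulas of
`index` agree. -/
lemma envelope_beliefLimit : envelope q ρ β (beliefLimit q ρ) = 0 := by
  have h1 : ∀ n, tangent q ρ β n (beliefLimit q ρ) =
      β ^ (n + 1) * ((1 - β) * (orbit q ρ (n + 1) - beliefLimit q ρ)) := fun n => by
    rw [tangent, h.drift_beliefLimit]
    ring
  refine ciSup_eq_of_forall_le_of_forall_lt_exists_gt (fun n => ?_) fun w hw => ?_
  · rw [h1]
    exact mul_nonpos_of_nonneg_of_nonpos (h.pow_nonneg _) (mul_nonpos_of_nonneg_of_nonpos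
      (sub_nonneg.2 h.β_lt_one.le) (sub_nonpos.2 (h.orbit_le_beliefLimit _)))
  · have h2 : Filter.Tendsto (fun n : ℕ => -β ^ (n + 1)) Filter.atTop (nhds (-0)) :=
      ((tendsto_pow_atTop_nhds_zero_of_lt_one h.β_nonneg h.β_lt_one).comp
        (Filter.tendsto_add_atTop_nat 1)).neg
    rw [neg_zero] at h2
    obtain ⟨n, hn⟩ := (h2.eventually (lt_mem_nhds hw)).exists
    refine ⟨n, hn.trans_le ?_⟩
    rw [h1, ← mul_neg_one]
    refine mul_le_mul_of_nonneg_left ?_ (h.pow_nonneg _)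
    have h3 := h.orbit_mem (n + 1)
    have h4 : beliefLimit q ρ ≤ 1 := h.beliefLimit_le.trans h.add_le_one
    nlinarith [h.β_nonneg, h.β_lt_one, h3.1, h.beliefLimit_nonneg]

lemma add_mul_pos {x : ℝ} (hx : 0 ≤ x) : 0 < 1 - β * (q + ρ) + β * x :=
  add_pos_of_pos_of_nonneg h.one_sub_pos (mul_nonneg h.β_nonneg hx)

lemma indexNum_beliefLimit :
    indexNum q ρ β (beliefLimit q ρ) = (1 - β) * beliefLimit q ρ := by
  rw [indexNum, h.drift_beliefLimit, h.envelope_beliefLimit]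
  ring

lemma indexDen_beliefLimit : indexDen q ρ β (beliefLimit q ρ) =
    (1 - β) * (1 - β * (q + ρ) + β * beliefLimit q ρ) := by
  rw [indexDen, h.drift_beliefLimit, h.envelope_beliefLimit]
  ring

omit h in
lemma index_of_le {x : ℝ} (hx : x ≤ beliefLimit q ρ) :
    index q ρ β x = indexNum q ρ β x / indexDen q ρ β x := if_pos hx

lemma index_of_mem {x : ℝ} (hx : x ∈ Icc (beliefLimit q ρ) (q + ρ)) :
    index q ρ β x = x / (1 - β * (q + ρ) + β * x) := by
  rcases hx.1.eq_or_lt with rfl | hlt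
  · rw [index_of_le le_rfl, h.indexNum_beliefLimit, h.indexDen_beliefLimit,
      mul_div_mul_left _ _ (sub_pos.2 h.β_lt_one).ne']
  · rw [index, if_neg hlt.not_ge, if_pos hx.2]

lemma index_of_ge {x : ℝ} (hx : q + ρ ≤ x) : index q ρ β x = x := by
  rcases hx.eq_or_lt with rfl | hlt
  · rw [h.index_of_mem ⟨h.beliefLimit_le, le_rfl⟩, sub_add_cancel, div_one]
  · rw [index, if_neg (h.beliefLimit_le.trans_lt hlt).not_ge, if_neg hlt.not_ge]

/-- The coefficients of the active resource value satisfy the hypotheses of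
`IsThresholdValue.wait_lt_active`. -/
lemma resource_wait_lt_active {n : ℕ} {z : ℝ} (hz : Below q ρ n z) {x : ℝ}
    (hx : x ∈ Icc (0 : ℝ) 1) :
    β * waitValue q ρ β z (fun x => (resourceCoeff q ρ β (β ^ (n + 1)) (orbit q ρ (n + 1))).1 +
        (resourceCoeff q ρ β (β ^ (n + 1)) (orbit q ρ (n + 1))).2 * x) (n + 2) (drift q ρ x) <
      (resourceCoeff q ρ β (β ^ (n + 1)) (orbit q ρ (n + 1))).1 +
        (resourceCoeff q ρ β (β ^ (n + 1)) (orbit q ρ (n + 1))).2 * x := by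
  have hy := h.orbit_mem (n + 1)
  have hyQ := h.orbit_succ_le n
  have hyn := h.orbit_le_succ n
  have ht := h.pow_succ_le n
  have ht0 := h.pow_nonneg (n + 1)
  have hc := h.one_sub_pos
  have hD := h.metricDenom_pos ht0 (h.pow_succ_lt_one n) hy.1
  have hb : 0 ≤ (resourceCoeff q ρ β (β ^ (n + 1)) (orbit q ρ (n + 1))).2 :=
    div_nonneg (sub_nonneg.2 ht) hD.le
  -- This reads `A 0 = 1 + β J q`: being active at belief `0` leads surely to `q`. It gives the `n +
  -- 1` bound required by `wait_lt_active` at once.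
  have ha : (resourceCoeff q ρ β (β ^ (n + 1)) (orbit q ρ (n + 1))).1 =
      1 + β ^ (n + 1) * ((resourceCoeff q ρ β (β ^ (n + 1)) (orbit q ρ (n + 1))).1 +
        (resourceCoeff q ρ β (β ^ (n + 1)) (orbit q ρ (n + 1))).2 * orbit q ρ (n + 1)) := by
    simp only [resourceCoeff]
    field_simp
    simp only [metricDenom]
    ring
  -- The resource consumption is at most `1 / (1 - β)`. This bounds the loss in replacing `β ^ (n +
  -- 1)` by `β ^ n` by `β ^ n`, which is less than `1` for `n ≠ 0`.
  have hL : (1 - β) * ((resourceCoeff q ρ β (β ^ (n + 1)) (orbit q ρ (n + 1))).1 +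
        (resourceCoeff q ρ β (β ^ (n + 1)) (orbit q ρ (n + 1))).2 * orbit q ρ (n + 1)) ≤ 1 := by
    simp only [resourceCoeff]
    rw [div_mul_eq_mul_div, ← add_div, ← mul_div_assoc, div_le_one hD]
    have h1 : (1 - β) * orbit q ρ (n + 1) ≤ 1 - β * (q + ρ) := by
      nlinarith [mul_le_mul_of_nonneg_left hyQ (sub_nonneg.2 h.β_lt_one.le), h.add_le_one]
    have h2 := mul_le_mul_of_nonneg_left h1 (sub_nonneg.2 ht)
    simp only [metricDenom]
    linarith
  have ha0 : 0 < (resourceCoeff q ρ β (β ^ (n + 1)) (orbit q ρ (n + 1))).1 :=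
    div_pos (add_pos_of_pos_of_nonneg hc (mul_nonneg ht0 hy.1)) hD
  have J := isThresholdValue_resource_below h hz
  set a := (resourceCoeff q ρ β (β ^ (n + 1)) (orbit q ρ (n + 1))).1
  set b := (resourceCoeff q ρ β (β ^ (n + 1)) (orbit q ρ (n + 1))).2
  refine J.wait_lt_active h hz hb ha0 (fun hn => ?_) (by linarith) hx
  have h1 : a + b * orbit q ρ n ≤ a + b * orbit q ρ (n + 1) := by gcongr
  have h2 := mul_le_mul_of_nonneg_left h1 (h.pow_nonneg n)
  obtain ⟨m, rfl⟩ := Nat.exists_eq_succ_of_ne_zero hn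
  have h3 := h.pow_succ_lt_one m
  have h4 := mul_le_mul_of_nonneg_left hL (h.pow_nonneg (m + 1))
  rw [pow_succ β (m + 1)] at ha
  simp only [Nat.succ_eq_add_one] at *
  linarith

omit h in
lemma drift_lt_of_below {n : ℕ} (h : Admissible q ρ β) {z : ℝ} (hz : Below q ρ n z) (h0 : 0 ≤ z) :
    z < drift q ρ z := by
  refine hz.lt.trans_le ?_
  rw [orbit_succ]
  exact h.drift_strictMono.monotone (hz.orbit_le h0)

lemma resource_marginal_of_below {n : ℕ} {z : ℝ} (hz : Below q ρ n z) :
    (resourceCoeff q ρ β (β ^ (n + 1)) (orbit q ρ (n + 1))).1 +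
        (resourceCoeff q ρ β (β ^ (n + 1)) (orbit q ρ (n + 1))).2 * z - β *
      ((resourceCoeff q ρ β (β ^ (n + 1)) (orbit q ρ (n + 1))).1 +
        (resourceCoeff q ρ β (β ^ (n + 1)) (orbit q ρ (n + 1))).2 * drift q ρ z) =
      indexDen q ρ β z / metricDenom q ρ β (β ^ (n + 1)) (orbit q ρ (n + 1)) := by
  rw [indexDen, h.envelope_of_below hz]
  simp only [resourceCoeff, tangent]
  ring

lemma reward_marginal_of_below {n : ℕ} {z : ℝ} (hz : Below q ρ n z) :
    (rewardCoeff q ρ β (β ^ (n + 1)) (orbit q ρ (n + 1))).1 +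
        (rewardCoeff q ρ β (β ^ (n + 1)) (orbit q ρ (n + 1))).2 * z - β *
      ((rewardCoeff q ρ β (β ^ (n + 1)) (orbit q ρ (n + 1))).1 +
        (rewardCoeff q ρ β (β ^ (n + 1)) (orbit q ρ (n + 1))).2 * drift q ρ z) =
      indexNum q ρ β z / metricDenom q ρ β (β ^ (n + 1)) (orbit q ρ (n + 1)) := by
  rw [indexNum, h.envelope_of_below hz]
  simp only [rewardCoeff, tangent]
  ring

/-- Up to the factor `metricDenom`, `indexDen z` is the marginal resource metric at `x = z`, already
known to be positive. -/
lemma indexDen_pos_of_below {n : ℕ} {z : ℝ} (hz : Below q ρ n z) (h0 : z ∈ Icc (0 : ℝ) 1) :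
    0 < indexDen q ρ β z := by
  have hD := h.metricDenom_pos (h.pow_nonneg (n + 1)) (h.pow_succ_lt_one n) (h.orbit_mem (n + 1)).1
  have h1 := h.resource_wait_lt_active hz h0
  rw [waitValue_of_lt (drift_lt_of_below h hz h0.1), ← sub_pos,
    h.resource_marginal_of_below hz] at h1
  exact (div_pos_iff_of_pos_right hD).1 h1

omit h in
lemma exists_below_of_lt {x : ℝ} (hx : x < beliefLimit q ρ) (h : Admissible q ρ β) :
    ∃ n, Below q ρ n x := by
  refine (exists_below_or q ρ x).resolve_right fun hle => ?_
  exact hx.not_ge (ciSup_le fun n => (h.orbit_le_succ n).trans (hle n))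

lemma indexDen_pos {x : ℝ} (hx : x ∈ Icc 0 (beliefLimit q ρ)) : 0 < indexDen q ρ β x := by
  rcases hx.2.eq_or_lt with rfl | hlt
  · rw [h.indexDen_beliefLimit]
    exact mul_pos (sub_pos.2 h.β_lt_one) (h.add_mul_pos hx.1)
  · obtain ⟨n, hn⟩ := exists_below_of_lt hlt h
    exact h.indexDen_pos_of_below hn ⟨hx.1, hx.2.trans (h.beliefLimit_le.trans h.add_le_one)⟩

lemma strictMonoOn_index : StrictMonoOn (index q ρ β) (Icc 0 1) := by
  have hβ := sub_pos.2 h.β_lt_one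
  have h1 : StrictMonoOn (index q ρ β) (Icc 0 (beliefLimit q ρ)) := by
    intro x hx y hy hxy
    rw [index_of_le hx.2, index_of_le hy.2, div_lt_div_iff₀ (h.indexDen_pos hx)
      (h.indexDen_pos hy)]
    -- Denominator minus numerator is `(1 - β) (1 - β ρ) (1 - x)`, since the envelope cancels. So
    -- the cross product is affine in the envelope at `y`, with nonnegative slope. Replacing that
    -- envelope by the tangent active at `x` leaves `(1 - β) (1 - β ρ) (y - x)` times `metricDenom`,
    -- which is positive.
    obtain ⟨n, hn⟩ := exists_below_of_lt (hxy.trans_le hy.2) h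
    have hD := h.metricDenom_pos (h.pow_nonneg (n + 1)) (h.pow_succ_lt_one n)
      (h.orbit_mem (n + 1)).1
    have hu := h.tangent_le_envelope n y
    have hs : 0 < (1 - β * ρ) * (y - x) := mul_pos h.one_sub_mul_pos (sub_pos.2 hxy)
    have hw : 0 ≤ (1 - β * ρ) * (1 - x) := mul_nonneg h.one_sub_mul_pos.le
      (sub_nonneg.2 (hx.2.trans (h.beliefLimit_le.trans h.add_le_one)))
    have hp := mul_pos hβ (mul_pos hs hD)
    have hn' := mul_nonneg hβ.le (mul_nonneg hw (sub_nonneg.2 hu))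
    simp only [indexNum, indexDen]
    rw [h.envelope_of_below hn]
    set U := envelope q ρ β y
    simp only [tangent, metricDenom, drift] at *
    linear_combination hp + hn'
  have h2 : StrictMonoOn (index q ρ β) (Icc (beliefLimit q ρ) (q + ρ)) := by
    intro x hx y hy hxy
    rw [h.index_of_mem hx, h.index_of_mem hy, div_lt_div_iff₀
      (h.add_mul_pos (h.beliefLimit_nonneg.trans hx.1))
      (h.add_mul_pos (h.beliefLimit_nonneg.trans hy.1))]
    have := mul_lt_mul_of_pos_left hxy h.one_sub_pos
    linarith
  have h3 : StrictMonoOn (index q ρ β) (Icc (q + ρ) 1) := fun x hx y hy hxy => by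
    rwa [h.index_of_ge hx.1, h.index_of_ge hy.1]
  have h12 := h1.union h2 (isGreatest_Icc h.beliefLimit_nonneg) (isLeast_Icc h.beliefLimit_le)
  rw [Icc_union_Icc_eq_Icc h.beliefLimit_nonneg h.beliefLimit_le] at h12
  have h123 := h12.union h3 (isGreatest_Icc h.add_mem.1) (isLeast_Icc h.add_mem.2)
  rwa [Icc_union_Icc_eq_Icc h.add_mem.1 h.add_mem.2] at h123

lemma continuousOn_index : ContinuousOn (index q ρ β) (Icc 0 1) := by
  have hdrift : Continuous fun x => x - β * drift q ρ x := by unfold drift; fun_prop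
  have hU := h.continuous_envelope
  have h1 : ContinuousOn (index q ρ β) (Icc 0 (beliefLimit q ρ)) := by
    refine ContinuousOn.congr (f := fun x => indexNum q ρ β x / indexDen q ρ β x) ?_
      fun x hx => index_of_le hx.2
    refine ContinuousOn.div ?_ ?_ fun x hx => (h.indexDen_pos hx).ne'
    · exact (hdrift.add hU).continuousOn
    · exact (((hdrift.const_mul β).add continuous_const).add hU).continuousOn
  have h2 : ContinuousOn (index q ρ β) (Icc (beliefLimit q ρ) (q + ρ)) := by
    refine ContinuousOn.congr (f := fun x => x / (1 - β * (q + ρ) + β * x)) ?_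
      fun x hx => h.index_of_mem hx
    exact ContinuousOn.div (by fun_prop) (by fun_prop) fun x hx =>
      (h.add_mul_pos (h.beliefLimit_nonneg.trans hx.1)).ne'
  have h3 : ContinuousOn (index q ρ β) (Icc (q + ρ) 1) :=
    continuousOn_id.congr fun x hx => h.index_of_ge hx.1
  have h12 := h1.union_of_isClosed h2 isClosed_Icc isClosed_Icc
  rw [Icc_union_Icc_eq_Icc h.beliefLimit_nonneg h.beliefLimit_le] at h12
  have h123 := h12.union_of_isClosed h3 isClosed_Icc isClosed_Icc
  rwa [Icc_union_Icc_eq_Icc h.add_mem.1 h.add_mem.2] at h123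

lemma index_zero : index q ρ β 0 = 0 := by
  rw [index_of_le h.beliefLimit_nonneg, indexNum]
  -- For `q = 0` the orbit is constantly `0`, so `0` is not below any orbit point and the envelope
  -- is computed directly.
  rcases h.q_nonneg.eq_or_lt with rfl | hq
  · have h0 : ∀ n, orbit 0 ρ n = 0 := fun n => by
      induction n with
      | zero => rfl
      | succ n ih => rw [orbit_succ, ih]; simp [drift]
    have h1 : envelope 0 ρ β 0 = 0 := by
      simp [envelope, tangent, h0, drift]
    simp [h1, drift]
  · have h1 : Below q ρ 0 0 := ⟨by rwa [zero_add, orbit_one], by simp⟩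
    rw [h.envelope_of_below h1]
    simp only [tangent, zero_add, orbit_one, drift]
    ring

lemma index_one : index q ρ β 1 = 1 := h.index_of_ge h.add_le_one

lemma index_mem {x : ℝ} (hx : x ∈ Icc (0 : ℝ) 1) : index q ρ β x ∈ Icc (0 : ℝ) 1 := by
  have h0 := h.strictMonoOn_index.monotoneOn (by simp) hx hx.1
  have h1 := h.strictMonoOn_index.monotoneOn hx (by simp) hx.2
  rw [h.index_zero] at h0
  rw [h.index_one] at h1
  exact ⟨h0, h1⟩

end Admissible

end

end GilbertElliott

/-! ### Metrics of all threshold policies and the sign of the marginal value. -/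

namespace GilbertElliott

/-- Summary of the properties of the `z`-policy metrics: `F`, `G` are the metrics of the `z`-policy
and `AF`, `AG` those of being active first. -/
structure ThresholdMetrics (q ρ β z : ℝ) (F AF G AG : ℝ → ℝ) : Prop where
  reward : IsThresholdValue q ρ β z 1 0 F AF
  resource : IsThresholdValue q ρ β z 0 1 G AG
  pos : ∀ x ∈ Icc (0 : ℝ) 1, β * G (drift q ρ x) < AG x
  slope : ∃ aF bF aG bG : ℝ, AF = (fun x => aF + bF * x) ∧ AG = (fun x => aG + bG * x) ∧
    0 ≤ bG ∧ bG < bF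
  marginal_eq : z ∈ Icc (0 : ℝ) 1 → AF z - β * F (drift q ρ z) =
    index q ρ β z * (AG z - β * G (drift q ρ z))
  rises_or_stuck : 0 ≤ z →
    (z < drift q ρ z ∧ ∀ x ∈ Icc (0 : ℝ) 1, ∃ k, z < (drift q ρ)^[k] x) ∨
    (drift q ρ z ≤ z ∧ ∀ x ≤ z, F x = 0 ∧ G x = 0)
  outer : z < 0 ∨ 1 ≤ z → ∀ x ∈ Icc (0 : ℝ) 1,
    AF x - β * F (drift q ρ x) = x ∧ AG x - β * G (drift q ρ x) = 1

section

variable {q ρ β : ℝ} (h : Admissible q ρ β)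
include h

namespace Admissible

lemma thresholdMetrics_of_below {n : ℕ} {z : ℝ} (hz : Below q ρ n z) :
    ThresholdMetrics q ρ β z
      (waitValue q ρ β z (fun x => (rewardCoeff q ρ β (β ^ (n + 1)) (orbit q ρ (n + 1))).1 +
        (rewardCoeff q ρ β (β ^ (n + 1)) (orbit q ρ (n + 1))).2 * x) (n + 2))
      (fun x => (rewardCoeff q ρ β (β ^ (n + 1)) (orbit q ρ (n + 1))).1 +
        (rewardCoeff q ρ β (β ^ (n + 1)) (orbit q ρ (n + 1))).2 * x)
      (waitValue q ρ β z (fun x => (resourceCoeff q ρ β (β ^ (n + 1)) (orbit q ρ (n + 1))).1 +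
        (resourceCoeff q ρ β (β ^ (n + 1)) (orbit q ρ (n + 1))).2 * x) (n + 2))
      (fun x => (resourceCoeff q ρ β (β ^ (n + 1)) (orbit q ρ (n + 1))).1 +
        (resourceCoeff q ρ β (β ^ (n + 1)) (orbit q ρ (n + 1))).2 * x) where
  reward := isThresholdValue_reward_below h hz
  resource := isThresholdValue_resource_below h hz
  pos x hx := h.resource_wait_lt_active hz hx
  slope := by
    have hD := h.metricDenom_pos (h.pow_nonneg (n + 1)) (h.pow_succ_lt_one n)
      (h.orbit_mem (n + 1)).1
    refine ⟨_, _, _, _, rfl, rfl, div_nonneg (sub_nonneg.2 (h.pow_succ_le n)) hD.le, ?_⟩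
    exact div_lt_div_of_pos_right (by linarith [h.β_lt_one]) hD
  marginal_eq hz01 := by
    have hd := drift_lt_of_below h hz hz01.1
    have hzl : z ≤ beliefLimit q ρ := hz.lt.le.trans (h.orbit_le_beliefLimit _)
    rw [waitValue_of_lt hd, waitValue_of_lt hd, h.reward_marginal_of_below hz,
      h.resource_marginal_of_below hz, index_of_le hzl, ← mul_div_assoc,
      div_mul_cancel₀ _ (h.indexDen_pos ⟨hz01.1, hzl⟩).ne']
  rises_or_stuck h0 := .inl ⟨drift_lt_of_below h hz h0, fun x hx =>
    ⟨n + 1, hz.lt.trans_le (h.orbit_le_iterate hx.1 _)⟩⟩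
  outer ho x hx := by
    -- A threshold below an orbit point is less than `1`, so here it is negative and `n = 0`: the
    -- policy is always active, and the first action does not change the expected next belief.
    have hz0 : z < 0 := ho.resolve_right fun h1 =>
      (hz.lt.trans_le (h.orbit_mem (n + 1)).2).not_ge h1
    have hn : n = 0 := by
      by_contra hn
      have := hz.le 0 (Nat.pos_of_ne_zero hn)
      exact (hz0.trans_le (h.orbit_mem 1).1).not_ge this
    subst hn
    have hd : z < drift q ρ x := hz0.trans_le (h.drift_mem_unit hx).1
    have hD : metricDenom q ρ β β q ≠ 0 := (h.metricDenom_pos h.β_nonneg h.β_lt_one h.q_nonneg).ne'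
    rw [waitValue_of_lt hd, waitValue_of_lt hd]
    simp only [zero_add, pow_one, orbit_one, rewardCoeff, resourceCoeff]
    constructor <;>
    · field_simp
      simp only [metricDenom, drift]
      ring

lemma thresholdMetrics_of_orbit_le {z : ℝ} (hz : ∀ n, orbit q ρ (n + 1) ≤ z) (hzQ : z < q + ρ) :
    ThresholdMetrics q ρ β z
      (waitValue q ρ β z (fun x => 0 + 1 / (1 - β * (q + ρ)) * x) 1)
      (fun x => 0 + 1 / (1 - β * (q + ρ)) * x)
      (waitValue q ρ β z (fun x => 1 + β / (1 - β * (q + ρ)) * x) 1)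
      (fun x => 1 + β / (1 - β * (q + ρ)) * x) := by
  have hc := h.one_sub_pos
  have hqz : q ≤ z := by simpa [orbit_one] using hz 0
  have hz0 : 0 ≤ z := h.q_nonneg.trans hqz
  have hdz := h.drift_le_self fun n => (h.orbit_le_succ n).trans (hz n)
  have hstuck : ∀ (A : ℝ → ℝ), ∀ x ≤ z, waitValue q ρ β z A 1 x = 0 := fun A x hx => by
    rw [waitValue_of_le hx, waitValue, mul_zero]
  have hb : 0 ≤ β / (1 - β * (q + ρ)) := div_nonneg h.β_nonneg hc.le
  refine ⟨isThresholdValue_of_drift_le h hdz hqz fun x => ?_,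
    isThresholdValue_of_drift_le h hdz hqz fun x => ?_, fun x hx => ?_, ⟨_, _, _, _, rfl, rfl, hb,
      div_lt_div_of_pos_right h.β_lt_one hc⟩, fun hz01 => ?_, fun _ => .inr ⟨hdz, fun x hx =>
      ⟨hstuck _ x hx, hstuck _ x hx⟩⟩, fun ho => ?_⟩
  · rw [if_pos hzQ]
    field_simp
    ring
  · rw [if_pos hzQ]
    field_simp
    ring
  · have hA : 0 < 1 + β / (1 - β * (q + ρ)) * x :=
      add_pos_of_pos_of_nonneg one_pos (mul_nonneg hb hx.1)
    rcases lt_or_ge z (drift q ρ x) with hd | hd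
    · have hzx : z ≤ x := by
        by_contra! hlt
        exact (hd.trans (h.drift_strictMono hlt)).not_ge hdz
      have hdx := h.drift_le_self_of_le hdz hzx
      rw [waitValue_of_lt hd]
      calc β * (1 + β / (1 - β * (q + ρ)) * drift q ρ x)
          ≤ β * (1 + β / (1 - β * (q + ρ)) * x) :=
            mul_le_mul_of_nonneg_left (by gcongr) h.β_nonneg
        _ < _ := mul_lt_of_lt_one_left hA h.β_lt_one
    · rw [hstuck _ _ hd, mul_zero]
      exact hA
  · have hl : beliefLimit q ρ ≤ z := ciSup_le fun n => (h.orbit_le_succ n).trans (hz n)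
    have hp := h.add_mul_pos hz0
    rw [hstuck _ _ hdz, hstuck _ _ hdz, h.index_of_mem ⟨hl, hzQ.le⟩]
    field_simp
    ring
  · rcases ho with ho | ho
    · exact absurd ho hz0.not_gt
    · exact absurd (hzQ.trans_le h.add_le_one) ho.not_gt

lemma thresholdMetrics_of_ge {z : ℝ} (hz : q + ρ ≤ z) :
    ThresholdMetrics q ρ β z
      (waitValue q ρ β z (fun x => 0 + 1 * x) 1) (fun x => 0 + 1 * x)
      (waitValue q ρ β z (fun x => 1 + 0 * x) 1) (fun x => 1 + 0 * x) := by
  have hqz : q ≤ z := by linarith [h.ρ_pos]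
  have hdz : drift q ρ z ≤ z := h.drift_le_self fun n =>
    ((h.orbit_le_succ n).trans (h.orbit_succ_le n)).trans hz
  have hstuck : ∀ (A : ℝ → ℝ), ∀ x ≤ z, waitValue q ρ β z A 1 x = 0 := fun A x hx => by
    rw [waitValue_of_le hx, waitValue, mul_zero]
  have hd : ∀ x ∈ Icc (0 : ℝ) 1, drift q ρ x ≤ z := fun x hx => (h.drift_mem hx).2.trans hz
  refine ⟨isThresholdValue_of_drift_le h hdz hqz fun x => ?_,
    isThresholdValue_of_drift_le h hdz hqz fun x => ?_, fun x hx => ?_, ⟨_, _, _, _, rfl, rfl,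
      le_rfl, one_pos⟩, fun hz01 => ?_, fun _ => .inr ⟨hdz, fun x hx =>
      ⟨hstuck _ x hx, hstuck _ x hx⟩⟩, fun _ x hx => ?_⟩
  · simp [hz.not_gt]
  · simp [hz.not_gt]
  · rw [hstuck _ _ (hd x hx)]
    simp
  · rw [hstuck _ _ hdz, hstuck _ _ hdz, h.index_of_ge hz]
    ring
  · rw [hstuck _ _ (hd x hx), hstuck _ _ (hd x hx)]
    constructor <;> ring

/-- The threshold metrics exist, and the resource metric is locally constant to the right. -/
lemma exists_thresholdMetrics (z : ℝ) : ∃ (AF AG : ℝ → ℝ) (N : ℕ),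
    ∀ᶠ z' in nhdsWithin z (Ici z),
      ThresholdMetrics q ρ β z' (waitValue q ρ β z' AF N) AF (waitValue q ρ β z' AG N) AG := by
  -- Each of the three regimes contains a right neighbourhood of `z`, on which the active values and
  -- the horizon do not change.
  rcases exists_below_or q ρ z with ⟨n, hn⟩ | hle
  · refine ⟨_, _, _, Filter.Eventually.mono (p := Below q ρ n) ?_
      fun _ => h.thresholdMetrics_of_below⟩
    filter_upwards [self_mem_nhdsWithin, nhdsWithin_le_nhds (Iio_mem_nhds hn.lt)] with z' hz hz'
    exact ⟨hz', fun j hj => (hn.le j hj).trans hz⟩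
  · rcases lt_or_ge z (q + ρ) with hQ | hQ
    · refine ⟨_, _, _, Filter.Eventually.mono (p := fun z' => (∀ n, orbit q ρ (n + 1) ≤ z') ∧
        z' < q + ρ) ?_ fun _ hz' => h.thresholdMetrics_of_orbit_le hz'.1 hz'.2⟩
      filter_upwards [self_mem_nhdsWithin, nhdsWithin_le_nhds (Iio_mem_nhds hQ)] with z' hz hz'
      exact ⟨fun n => (hle n).trans hz, hz'⟩
    · refine ⟨_, _, _, Filter.Eventually.mono (p := fun z' => q + ρ ≤ z') ?_
        fun _ => h.thresholdMetrics_of_ge⟩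
      filter_upwards [self_mem_nhdsWithin] with z' hz
      exact hQ.trans hz

end Admissible

/-- At the price that makes both actions equivalent at `z`, the active action is strictly better
above `z` and the passive one strictly better below `z`. -/
lemma ThresholdMetrics.marginal_sign {z : ℝ} {F AF G AG : ℝ → ℝ}
    (hM : ThresholdMetrics q ρ β z F AF G AG) (hz : z ∈ Icc (0 : ℝ) 1) {x : ℝ}
    (hx : x ∈ Icc (0 : ℝ) 1) :
    (x < z → AF x - β * F (drift q ρ x) <
      index q ρ β z * (AG x - β * G (drift q ρ x))) ∧
    (z < x → index q ρ β z * (AG x - β * G (drift q ρ x)) <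
      AF x - β * F (drift q ρ x)) := by
  obtain ⟨aF, bF, aG, bG, hAF, hAG, hbG, hb⟩ := hM.slope
  have hc1 : index q ρ β z ≤ 1 := (h.index_mem hz).2
  have hV := hM.reward.sub_mul hM.resource (index q ρ β z)
  have hind := hM.marginal_eq hz
  set c := index q ρ β z
  -- The price is at most `1` and the resource slope is nonnegative and smaller than the reward
  -- slope, so the active net value is strictly increasing.
  obtain ⟨a, b, hb0, hA⟩ : ∃ a b : ℝ, 0 < b ∧ ∀ y, AF y - c * AG y = a + b * y := by
    refine ⟨aF - c * aG, bF - c * bG, ?_, fun y => ?_⟩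
    · linarith [mul_le_of_le_one_left hbG hc1]
    · rw [hAF, hAG]; ring
  have hact : ∀ y ∈ Icc (0 : ℝ) 1, z < y → F y - c * G y = a + b * y := fun y hy hzy =>
    (hV.active y hy hzy).trans (hA y)
  have hpas : ∀ y ∈ Icc (0 : ℝ) 1, y ≤ z → F y - c * G y =
    β * (F (drift q ρ y) - c * G (drift q ρ y)) := hV.passive
  have hzero : a + b * z = β * (F (drift q ρ z) - c * G (drift q ρ z)) := by
    rw [← hA]; linear_combination hind
  suffices hs : (x < z → a + b * x < β * (F (drift q ρ x) - c * G (drift q ρ x))) ∧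
      (z < x → β * (F (drift q ρ x) - c * G (drift q ρ x)) < a + b * x) by
    rw [← hA] at hs
    exact ⟨fun hxz => by linarith [hs.1 hxz], fun hxz => by linarith [hs.2 hxz]⟩
  have hdm : ∀ {y}, y ∈ Icc (0 : ℝ) 1 → drift q ρ y ∈ Icc (0 : ℝ) 1 := h.drift_mem_unit
  rcases hM.rises_or_stuck hz.1 with ⟨hup, hhit⟩ | ⟨hdown, hnull⟩
  · rw [hact _ (hdm hz) hup] at hzero
    -- The gain of acting now over acting one period later is affine, and the tie at `z` makes `z`
    -- its zero.
    have hslope : ∀ y, (a + b * y) - β * (a + b * drift q ρ y) = b * (1 - β * ρ) * (y - z) :=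
      fun y => by simp only [drift] at *; linear_combination hzero
    have hk := mul_pos hb0 h.one_sub_mul_pos
    refine ⟨fun hxz => ?_, fun hxz => ?_⟩
    -- Induction on the waiting time: at or below `z` the policy's value is at least that of acting
    -- at once, so waiting from `x < z` is worth at least acting one period later, which beats
    -- acting now.
    · have hle : ∀ k, ∀ y ∈ Icc (0 : ℝ) 1, y ≤ z → z < (drift q ρ)^[k] y →
          a + b * y ≤ F y - c * G y := by
        intro k
        induction k with
        | zero => intro y _ hy hy'; exact absurd hy (not_le.2 hy')
        | succ k ih =>
          intro y hy hyz hyk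
          rw [hpas y hy hyz]
          have h1 : a + b * drift q ρ y ≤ F (drift q ρ y) - c * G (drift q ρ y) := by
            rcases lt_or_ge z (drift q ρ y) with hd | hd
            · exact (hact _ (hdm hy) hd).ge
            · exact ih _ (hdm hy) hd hyk
          have h2 := mul_nonneg hk.le (sub_nonneg.2 hyz)
          have h3 := mul_le_mul_of_nonneg_left h1 h.β_nonneg
          linarith [hslope y]
      have h1 : a + b * drift q ρ x ≤ F (drift q ρ x) - c * G (drift q ρ x) := by
        rcases lt_or_ge z (drift q ρ x) with hd | hd
        · exact (hact _ (hdm hx) hd).ge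
        · obtain ⟨k, hk'⟩ := hhit _ (hdm hx)
          exact hle k _ (hdm hx) hd hk'
      have h2 := mul_pos hk (sub_pos.2 hxz)
      have h3 := mul_le_mul_of_nonneg_left h1 h.β_nonneg
      linarith [hslope x]
    · rw [hact _ (hdm hx) (hup.trans (h.drift_strictMono hxz))]
      have h2 := mul_pos hk (sub_pos.2 hxz)
      linarith [hslope x]
  · have hval : ∀ y ≤ z, F y - c * G y = 0 := fun y hy => by
      rw [(hnull y hy).1, (hnull y hy).2]; ring
    rw [hval _ hdown, mul_zero] at hzero
    refine ⟨fun hxz => ?_, fun hxz => ?_⟩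
    · rw [hval _ ((h.drift_strictMono hxz).le.trans hdown), mul_zero]
      linarith [mul_lt_mul_of_pos_left hxz hb0]
    · have hpos : 0 < a + b * x := by linarith [mul_lt_mul_of_pos_left hxz hb0]
      rcases lt_or_ge z (drift q ρ x) with hd | hd
      · rw [hact _ (hdm hx) hd]
        have hdx := h.drift_le_self_of_le hdown hxz.le
        calc β * (a + b * drift q ρ x) ≤ β * (a + b * x) :=
              mul_le_mul_of_nonneg_left (by gcongr) h.β_nonneg
          _ < _ := mul_lt_of_lt_one_left hpos h.β_lt_one
      · rw [hval _ hd, mul_zero]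
        exact hpos

end

end GilbertElliott

/-! ### Stieltjes integrals from squeezed increments. -/

lemma StieltjesFunction.setIntegral_bounds (S : StieltjesFunction ℝ) {m : ℝ → ℝ} (hm : Monotone m)
    (hc : Continuous m) {a b : ℝ} (hab : a ≤ b) :
    m a * (S b - S a) ≤ ∫ z in Ioc a b, m z ∂S.measure ∧
      ∫ z in Ioc a b, m z ∂S.measure ≤ m b * (S b - S a) := by
  have hint : IntegrableOn m (Ioc a b) S.measure := hc.integrableOn_Ioc
  have hconst : ∀ c : ℝ, ∫ _ in Ioc a b, c ∂S.measure = c * (S b - S a) := fun c => by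
    rw [setIntegral_const, measureReal_def, S.measure_Ioc,
      ENNReal.toReal_ofReal (sub_nonneg.2 (S.mono hab)), smul_eq_mul, mul_comm]
  have hfin : S.measure (Ioc a b) ≠ ⊤ := by rw [S.measure_Ioc]; exact ENNReal.ofReal_ne_top
  have hci : ∀ c : ℝ, IntegrableOn (fun _ => c) (Ioc a b) S.measure := fun c =>
    integrableOn_const hfin
  rw [← hconst, ← hconst]
  exact ⟨setIntegral_mono_on (hci _) hint measurableSet_Ioc fun z hz => hm hz.1.le,
    setIntegral_mono_on hint (hci _) measurableSet_Ioc fun z hz => hm hz.2⟩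

/-- A function whose increments are squeezed between `m a (S b - S a)` and `m b (S b - S a)` is an
indefinite Lebesgue-Stieltjes integral of `m`. -/
lemma StieltjesFunction.sub_eq_setIntegral (S : StieltjesFunction ℝ) {m H : ℝ → ℝ}
    (hm : Monotone m) (hc : Continuous m)
    (hH : ∀ a b, a < b → m a * (S b - S a) ≤ H b - H a ∧ H b - H a ≤ m b * (S b - S a))
    {a b : ℝ} (hab : a < b) : H b - H a = ∫ z in Ioc a b, m z ∂S.measure := by
  rw [← sub_eq_zero, ← abs_nonpos_iff]
  refine le_of_forall_pos_le_add fun ε hε => ?_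
  have hS : 0 ≤ S b - S a := sub_nonneg.2 (S.mono hab.le)
  -- On a mesh finer than `δ` each cell contributes an error of at most the oscillation of `m` times
  -- the increment of `S`. The `+ 1` avoids dividing by zero when `S` is constant on the interval.
  obtain ⟨δ, hδ, hδm⟩ := Metric.uniformContinuousOn_iff.1
    (isCompact_Icc.uniformContinuousOn_of_continuous (hc.continuousOn (s := Icc a b)))
    (ε / (S b - S a + 1)) (by positivity)
  obtain ⟨N, hN⟩ := exists_nat_gt ((b - a) / δ)
  have hN0 : (0 : ℝ) < N := (div_pos (sub_pos.2 hab) hδ).trans hN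
  set s : ℝ := (b - a) / N with hs
  have hs0 : 0 < s := div_pos (sub_pos.2 hab) hN0
  have hsδ : s < δ := by rw [hs, div_lt_comm₀ hN0 hδ]; exact hN
  have hNs : N * s = b - a := mul_div_cancel₀ _ hN0.ne'
  set x : ℕ → ℝ := fun k => a + k * s with hx
  have hx0 : x 0 = a := by simp [hx]
  have hxN : x N = b := by simp only [hx, hNs]; ring
  have hxs : ∀ k, x (k + 1) = x k + s := fun k => by simp only [hx]; push_cast; ring
  have hxmem : ∀ k ≤ N, x k ∈ Icc a b := fun k hk => by
    have h1 : (k : ℝ) * s ≤ N * s := mul_le_mul_of_nonneg_right (by exact_mod_cast hk) hs0.le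
    have h2 : 0 ≤ (k : ℝ) * s := by positivity
    constructor <;> simp only [hx] <;> linarith
  have hadd : H b - H a - ∫ z in Ioc a b, m z ∂S.measure =
      ∑ k ∈ Finset.range N, (H (x (k + 1)) - H (x k) -
        ∫ z in Ioc (x k) (x (k + 1)), m z ∂S.measure) := by
    rw [Finset.sum_sub_distrib, Finset.sum_range_sub (fun k => H (x k)), hx0, hxN,
      ← intervalIntegral.integral_of_le hab.le]
    congr 1
    rw [← hx0, ← hxN, ← intervalIntegral.sum_integral_adjacent_intervals
      fun k _ => hc.intervalIntegrable _ _]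
    refine Finset.sum_congr rfl fun k _ => ?_
    rw [intervalIntegral.integral_of_le (by rw [hxs]; linarith)]
  rw [hadd, zero_add]
  calc |∑ k ∈ Finset.range N, (H (x (k + 1)) - H (x k) -
        ∫ z in Ioc (x k) (x (k + 1)), m z ∂S.measure)|
      ≤ ∑ k ∈ Finset.range N, ε / (S b - S a + 1) * (S (x (k + 1)) - S (x k)) := by
        refine (Finset.abs_sum_le_sum_abs _ _).trans (Finset.sum_le_sum fun k hk => ?_)
        have hkN := Finset.mem_range.1 hk
        have hlt : x k < x (k + 1) := by rw [hxs]; linarith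
        have h1 := hH _ _ hlt
        have h2 := S.setIntegral_bounds hm hc hlt.le
        have h3 : 0 ≤ S (x (k + 1)) - S (x k) := sub_nonneg.2 (S.mono hlt.le)
        have h4 : m (x (k + 1)) - m (x k) ≤ ε / (S b - S a + 1) := by
          have := hδm _ (hxmem (k + 1) hkN) _ (hxmem k hkN.le) (by
            rw [hxs, Real.dist_eq, add_sub_cancel_left, abs_of_pos hs0]; exact hsδ)
          rw [Real.dist_eq] at this
          exact (le_abs_self _).trans this.le
        refine le_trans ?_ (mul_le_mul_of_nonneg_right h4 h3)
        rw [abs_le]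
        constructor <;> linarith
    _ = ε * ((S b - S a) / (S b - S a + 1)) := by
        rw [← Finset.mul_sum, Finset.sum_range_sub (fun k => S (x k)), hx0, hxN]
        ring
    _ ≤ ε := mul_le_of_le_one_right hε.le (div_le_one_of_le₀ (by linarith) (by linarith))

/-! ### From real functions to the belief-state project. -/

namespace GilbertElliott

section

variable {p q β : ℝ} (hp : p ∈ Icc (0 : ℝ) 1) (hq : q ∈ Icc (0 : ℝ) 1)
  (hβ : β ∈ Ico (0 : ℝ) 1)

lemma admissible (hρ : 0 < 1 - p - q) (hp : p ∈ Icc (0 : ℝ) 1) (hq : q ∈ Icc (0 : ℝ) 1)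
    (hβ : β ∈ Ico (0 : ℝ) 1) : Admissible q (1 - p - q) β :=
  ⟨hq.1, hρ, by linarith [hp.1], hβ.1, hβ.2⟩

lemma coe_nextBelief (x : Icc (0 : ℝ) 1) :
    (nextBelief p q hp hq x : ℝ) = drift q (1 - p - q) x := rfl

lemma integral_transition_true (J : ℝ → ℝ) (x : Icc (0 : ℝ) 1) :
    ∫ y, J y ∂(project p q β hp hq hβ).transition true x =
      x * J (q + (1 - p - q)) + (1 - x) * J q := by
  have h1 : (project p q β hp hq hβ).transition true x =
      ENNReal.ofReal x • Measure.dirac (nextBelief p q hp hq 1) +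
        ENNReal.ofReal (1 - x) • Measure.dirac (nextBelief p q hp hq 0) := rfl
  have hi : ∀ y : Icc (0 : ℝ) 1, Integrable (fun y : Icc (0 : ℝ) 1 => J y) (Measure.dirac y) :=
    fun y => integrable_dirac enorm_lt_top
  rw [h1, integral_add_measure ((hi _).smul_measure ENNReal.ofReal_ne_top)
    ((hi _).smul_measure ENNReal.ofReal_ne_top), integral_smul_measure, integral_smul_measure,
    integral_dirac, integral_dirac, ENNReal.toReal_ofReal x.2.1,
    ENNReal.toReal_ofReal (sub_nonneg.2 x.2.2)]
  simp [coe_nextBelief, drift]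

lemma integral_transition_false (J : ℝ → ℝ) (x : Icc (0 : ℝ) 1) :
    ∫ y, J y ∂(project p q β hp hq hβ).transition false x = J (drift q (1 - p - q) x) := by
  have h1 : (project p q β hp hq hβ).transition false x =
      Measure.dirac (nextBelief p q hp hq x) :=
    Kernel.deterministic_apply (measurable_nextBelief p q hp hq) x
  rw [h1, integral_dirac, coe_nextBelief]

/-- The payoff `a (r₁ x + r₀)`. -/
def affinePayoff (r₁ r₀ : ℝ) (x : Icc (0 : ℝ) 1) (a : Bool) : ℝ := if a then r₁ * x + r₀ else 0

lemma measurable_affinePayoff (r₁ r₀ : ℝ) : Measurable (Function.uncurry (affinePayoff r₁ r₀)) :=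
  measurable_from_prod_countable_left fun a => by
    cases a
    · exact measurable_const
    · change Measurable fun x : Icc (0 : ℝ) 1 => r₁ * (x : ℝ) + r₀
      fun_prop

lemma abs_affinePayoff_le (r₁ r₀ : ℝ) (x : Icc (0 : ℝ) 1) (a : Bool) :
    |affinePayoff r₁ r₀ x a| ≤ |r₁| + |r₀| := by
  cases a
  · simp only [affinePayoff, Bool.false_eq_true, if_false, abs_zero]; positivity
  · simp only [affinePayoff, if_true]
    refine (abs_add_le _ _).trans (add_le_add ?_ le_rfl)
    rw [abs_mul, abs_of_nonneg x.2.1]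
    exact mul_le_of_le_one_right (abs_nonneg _) x.2.2

lemma reward_eq : (project p q β hp hq hβ).reward = affinePayoff 1 0 := by
  funext x a; simp [project, affinePayoff]

lemma resource_eq : (project p q β hp hq hβ).resource = affinePayoff 0 1 := by
  funext x a; simp [project, affinePayoff]

lemma net_eq (c : ℝ) : (fun y a => (project p q β hp hq hβ).reward y a -
    c * (project p q β hp hq hβ).resource y a) = affinePayoff 1 (-c) := by
  funext x a
  rw [reward_eq, resource_eq]
  cases a <;> simp [affinePayoff, sub_eq_add_neg]

variable {z r₁ r₀ : ℝ} {J A : ℝ → ℝ}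

lemma residual_true (hJ : IsThresholdValue q (1 - p - q) β z r₁ r₀ J A) (x : Icc (0 : ℝ) 1) :
    (project p q β hp hq hβ).residual (affinePayoff r₁ r₀) (fun y => J y) (x, true) =
      A x - J x := by
  simp only [RestlessProject.residual, integral_transition_true, hJ.first x, affinePayoff, if_true]
  rfl

lemma residual_false (x : Icc (0 : ℝ) 1) :
    (project p q β hp hq hβ).residual (affinePayoff r₁ r₀) (fun y => J y) (x, false) =
      β * J (drift q (1 - p - q) x) - J x := by
  simp only [RestlessProject.residual, integral_transition_false, affinePayoff,
    Bool.false_eq_true, if_false, zero_add]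
  rfl

lemma discountedPayoff_threshold (hJ : IsThresholdValue q (1 - p - q) β z r₁ r₀ J A) {w : EReal}
    (hw : ∀ x : Icc (0 : ℝ) 1, w < ((x : ℝ) : EReal) ↔ z < x) (x : Icc (0 : ℝ) 1) :
    (project p q β hp hq hβ).discountedPayoff (affinePayoff r₁ r₀) x (thresholdPolicy 0 1 w) = J x ∧
    (project p q β hp hq hβ).discountedPayoff (affinePayoff r₁ r₀) x
      ((thresholdPolicy 0 1 w).precede true) = A x ∧
    (project p q β hp hq hβ).discountedPayoff (affinePayoff r₁ r₀) x
      ((thresholdPolicy 0 1 w).precede false) = β * J (drift q (1 - p - q) x) := by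
  obtain ⟨C, hC⟩ := hJ.bounded
  have hJm : Measurable fun y : Icc (0 : ℝ) 1 => J y := hJ.measurable.comp measurable_subtype_coe
  have h1 : ∀ y ∈ {x : Icc (0 : ℝ) 1 | w < ((x : ℝ) : EReal)},
      (project p q β hp hq hβ).residual (affinePayoff r₁ r₀) (fun y => J y) (y, true) = 0 :=
    fun y hy => by
      rw [residual_true hp hq hβ hJ, hJ.active y y.2 ((hw y).1 hy), sub_self]
  have h0 : ∀ y ∉ {x : Icc (0 : ℝ) 1 | w < ((x : ℝ) : EReal)},
      (project p q β hp hq hβ).residual (affinePayoff r₁ r₀) (fun y => J y) (y, false) = 0 :=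
    fun y hy => by
      rw [residual_false, ← hJ.passive y y.2 (not_lt.1 fun hlt => hy ((hw y).2 hlt)), sub_self]
  have hr := measurable_affinePayoff r₁ r₀
  have hK := abs_affinePayoff_le r₁ r₀
  refine ⟨(project p q β hp hq hβ).discountedPayoff_ofRegion hr hK hJm (fun y => hC y y.2)
    (measurableSet_above w) h1 h0 x, ?_, ?_⟩
  · refine ((project p q β hp hq hβ).discountedPayoff_precede_ofRegion hr hK hJm
      (fun y => hC y y.2) (measurableSet_above w) h1 h0 x true).trans ?_
    rw [integral_transition_true, hJ.first x, affinePayoff, if_pos rfl]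
    rfl
  · refine ((project p q β hp hq hβ).discountedPayoff_precede_ofRegion hr hK hJm
      (fun y => hC y y.2) (measurableSet_above w) h1 h0 x false).trans ?_
    rw [integral_transition_false, affinePayoff, if_neg Bool.false_ne_true, zero_add]
    rfl

/-- The first two inequalities make `J` the maximum of the two action values. The region `B` need
not be the one defining `J`: any region choosing a maximizer at each state is optimal, so `z` and
`z⁻` policies are treated alike when the actions tie at `z`. -/
lemma bellman_ofRegion {c : ℝ} (hJ : IsThresholdValue q (1 - p - q) β z 1 (-c) J A)
    (hle : ∀ x ∈ Icc (0 : ℝ) 1, x ≤ z → A x ≤ β * J (drift q (1 - p - q) x))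
    (hlt : ∀ x ∈ Icc (0 : ℝ) 1, z < x → β * J (drift q (1 - p - q) x) ≤ A x)
    {B : Set (Icc (0 : ℝ) 1)} (hB : MeasurableSet B)
    (h1 : ∀ x ∈ B, β * J (drift q (1 - p - q) x) ≤ A x)
    (h0 : ∀ x ∉ B, A x ≤ β * J (drift q (1 - p - q) x)) :
    (∀ x π, (project p q β hp hq hβ).netValue c x π ≤
      (project p q β hp hq hβ).netValue c x (.ofRegion B hB)) ∧
      (project p q β hp hq hβ).IsOptimal c (.ofRegion B hB) ∧
      (project p q β hp hq hβ).optimalValue c = fun x : Icc (0 : ℝ) 1 => J x := by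
  obtain ⟨C, hC⟩ := hJ.bounded
  have hmax : ∀ x : Icc (0 : ℝ) 1, J x = max (A x) (β * J (drift q (1 - p - q) x)) := fun x => by
    rcases lt_or_ge z x with hx | hx
    · rw [hJ.active x x.2 hx, max_eq_left (hlt x x.2 hx)]
    · rw [max_eq_right (hle x x.2 hx), ← hJ.passive x x.2 hx]
  refine (project p q β hp hq hβ).optimal_of_bellman (J := fun x : Icc (0 : ℝ) 1 => J x) (C := C)
    (KF := |1| + |0|) (KG := |0| + |1|) (hJ.measurable.comp measurable_subtype_coe)
    (fun y => hC y y.2) ?_ ?_ ?_ ?_ ?_ hB ?_ ?_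
  · rw [reward_eq]; exact measurable_affinePayoff 1 0
  · rw [resource_eq]; exact measurable_affinePayoff 0 1
  · rw [reward_eq]; exact abs_affinePayoff_le 1 0
  · rw [resource_eq]; exact abs_affinePayoff_le 0 1
  · rintro ⟨x, a⟩
    rw [net_eq]
    cases a
    · rw [residual_false, hmax x]; exact sub_nonpos.2 (le_max_right _ _)
    · rw [residual_true hp hq hβ hJ, hmax x]; exact sub_nonpos.2 (le_max_left _ _)
  · intro x hx
    rw [net_eq, residual_true hp hq hβ hJ, hmax x, max_eq_left (h1 x hx), sub_self]
  · intro x hx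
    rw [net_eq, residual_false, hmax x, max_eq_right (h0 x hx), sub_self]

end

end GilbertElliott

/-! ### The three PCL conditions and strong threshold-indexability. -/

namespace GilbertElliott

variable {p q β : ℝ} (hp : p ∈ Icc (0 : ℝ) 1) (hq : q ∈ Icc (0 : ℝ) 1)
  (hβ : β ∈ Ico (0 : ℝ) 1)

section metrics

variable {z : ℝ} {F AF G AG : ℝ → ℝ} (hM : ThresholdMetrics q (1 - p - q) β z F AF G AG)
  {w : EReal} (hw : ∀ x : Icc (0 : ℝ) 1, w < ((x : ℝ) : EReal) ↔ z < x) (x : Icc (0 : ℝ) 1)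
include hM hw

lemma resourceMetric_threshold :
    (project p q β hp hq hβ).resourceMetric x (thresholdPolicy 0 1 w) = G x := by
  have := (discountedPayoff_threshold hp hq hβ hM.resource hw x).1
  rwa [← resource_eq hp hq hβ] at this

lemma marginalReward_threshold :
    (project p q β hp hq hβ).marginalReward x (thresholdPolicy 0 1 w) =
      AF x - β * F (drift q (1 - p - q) x) := by
  have := (discountedPayoff_threshold hp hq hβ hM.reward hw x).2
  rw [← reward_eq hp hq hβ] at this
  exact congrArg₂ (· - ·) this.1 this.2

lemma marginalResource_threshold :
    (project p q β hp hq hβ).marginalResource x (thresholdPolicy 0 1 w) =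
      AG x - β * G (drift q (1 - p - q) x) := by
  have := (discountedPayoff_threshold hp hq hβ hM.resource hw x).2
  rw [← resource_eq hp hq hβ] at this
  exact congrArg₂ (· - ·) this.1 this.2

end metrics

lemma coe_lt_coe_iff (z : ℝ) (x : Icc (0 : ℝ) 1) : (z : EReal) < ((x : ℝ) : EReal) ↔ z < x :=
  EReal.coe_lt_coe_iff

/-- Beliefs lie in `[0, 1]`, so infinite thresholds act like `-1` (always active) and `1` (never
active, the comparison being strict). -/
lemma exists_real_threshold (w : EReal) :
    ∃ z : ℝ, ∀ x : Icc (0 : ℝ) 1, w < ((x : ℝ) : EReal) ↔ z < x := by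
  induction w with
  | bot => exact ⟨-1, fun x => iff_of_true (EReal.bot_lt_coe _) (by linarith [x.2.1])⟩
  | coe z => exact ⟨z, coe_lt_coe_iff z⟩
  | top => exact ⟨1, fun x => iff_of_false not_top_lt (not_lt.2 x.2.2)⟩

variable (hρ : 0 < 1 - p - q)

include hρ hβ hp hq in
lemma exists_metrics (z : ℝ) :
    ∃ F AF G AG : ℝ → ℝ, ThresholdMetrics q (1 - p - q) β z F AF G AG := by
  obtain ⟨AF, AG, N, hev⟩ := (admissible hρ hp hq hβ).exists_thresholdMetrics z
  exact ⟨_, _, _, _, hev.self_of_nhdsWithin self_mem_Ici⟩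

include hρ

lemma pcli1 : (project p q β hp hq hβ).PCLI1 := by
  intro x w
  obtain ⟨z, hz⟩ := exists_real_threshold w
  obtain ⟨F, AF, G, AG, hM⟩ := exists_metrics hp hq hβ hρ z
  rw [marginalResource_threshold hp hq hβ hM hz]
  exact sub_pos.2 (hM.pos x x.2)

lemma mpIndex_eq (x : Icc (0 : ℝ) 1) :
    (project p q β hp hq hβ).mpIndex x = index q (1 - p - q) β x := by
  obtain ⟨F, AF, G, AG, hM⟩ := exists_metrics hp hq hβ hρ x
  rw [RestlessProject.mpIndex, marginalReward_threshold hp hq hβ hM (coe_lt_coe_iff _),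
    marginalResource_threshold hp hq hβ hM (coe_lt_coe_iff _), hM.marginal_eq x.2,
    mul_div_cancel_right₀ _ (sub_pos.2 (hM.pos x x.2)).ne']

lemma mpIndex_strictMono : StrictMono (project p q β hp hq hβ).mpIndex := fun x y hxy => by
  rw [mpIndex_eq hp hq hβ hρ, mpIndex_eq hp hq hβ hρ]
  exact (admissible hρ hp hq hβ).strictMonoOn_index x.2 y.2 hxy

lemma continuous_mpIndex : Continuous (project p q β hp hq hβ).mpIndex := by
  rw [funext (mpIndex_eq hp hq hβ hρ)]
  exact (admissible hρ hp hq hβ).continuousOn_index.domRestrict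

lemma pcli2 : (project p q β hp hq hβ).PCLI2 := by
  refine ⟨(mpIndex_strictMono hp hq hβ hρ).monotone, continuous_mpIndex hp hq hβ hρ,
    (project p q β hp hq hβ).mpIndex ⟨0, by simp⟩, ?_⟩
  rintro _ ⟨x, rfl⟩
  exact (mpIndex_strictMono hp hq hβ hρ).monotone x.2.1

/-- A threshold `z` and a price `c` that fit together. -/
def IsMatching (q ρ β z c : ℝ) : Prop :=
  (z ∈ Icc (0 : ℝ) 1 ∧ c = index q ρ β z) ∨ (z < 0 ∧ c ≤ 0) ∨ (1 ≤ z ∧ 1 ≤ c)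

omit hρ in
lemma ThresholdMetrics.marginal_of_matching (h : Admissible q (1 - p - q) β) {z c : ℝ}
    {F AF G AG : ℝ → ℝ} (hM : ThresholdMetrics q (1 - p - q) β z F AF G AG)
    (hzc : IsMatching q (1 - p - q) β z c) {x : ℝ} (hx : x ∈ Icc (0 : ℝ) 1) :
    (x ≤ z → AF x - c * AG x ≤ β * (F (drift q (1 - p - q) x) - c * G (drift q (1 - p - q) x))) ∧
    (z < x → β * (F (drift q (1 - p - q) x) - c * G (drift q (1 - p - q) x)) ≤
      AF x - c * AG x) := by
  rcases hzc with ⟨hz, rfl⟩ | ⟨hz, hc⟩ | ⟨hz, hc⟩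
  · refine ⟨fun hxz => ?_, fun hxz => ?_⟩
    · rcases hxz.eq_or_lt with rfl | hlt
      · linarith [hM.marginal_eq hz]
      · linarith [(hM.marginal_sign h hz hx).1 hlt]
    · linarith [(hM.marginal_sign h hz hx).2 hxz]
  · obtain ⟨h1, h2⟩ := hM.outer (.inl hz) x hx
    refine ⟨fun hxz => absurd (hx.1.trans hxz) hz.not_ge, fun _ => ?_⟩
    have : c * (AG x - β * G (drift q (1 - p - q) x)) = c := by rw [h2, mul_one]
    linarith [hx.1]
  · obtain ⟨h1, h2⟩ := hM.outer (.inr hz) x hx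
    refine ⟨fun _ => ?_, fun hxz => absurd (hz.trans_lt hxz) hx.2.not_gt⟩
    have : c * (AG x - β * G (drift q (1 - p - q) x)) = c := by rw [h2, mul_one]
    linarith [hx.2]

lemma netValue_le_of_matching {z c : ℝ} (hzc : IsMatching q (1 - p - q) β z c)
    (x : Icc (0 : ℝ) 1) (π : ControlPolicy (Icc (0 : ℝ) 1)) :
    (project p q β hp hq hβ).netValue c x π ≤
      (project p q β hp hq hβ).netValue c x (thresholdPolicy 0 1 (z : EReal)) := by
  have h := admissible hρ hp hq hβ
  obtain ⟨F, AF, G, AG, hM⟩ := exists_metrics hp hq hβ hρ z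
  have hs := fun x hx => hM.marginal_of_matching h hzc (x := x) hx
  refine (bellman_ofRegion hp hq hβ (hM.reward.sub_mul hM.resource c) (fun x hx => (hs x hx).1)
    (fun x hx => (hs x hx).2) (measurableSet_above _) (fun x hx => (hs x x.2).2 ?_)
    (fun x hx => (hs x x.2).1 ?_)).1 x π
  · exact (coe_lt_coe_iff z x).1 hx
  · exact not_lt.1 fun hlt => hx ((coe_lt_coe_iff z x).2 hlt)

lemma isMatching_mpIndexExt (z : ℝ) :
    IsMatching q (1 - p - q) β z ((project p q β hp hq hβ).mpIndexExt z) := by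
  have h := admissible hρ hp hq hβ
  rcases lt_or_ge z 0 with hz | hz
  · refine .inr (.inl ⟨hz, ?_⟩)
    rw [RestlessProject.mpIndexExt, IccExtend_of_le_left _ _ hz.le, mpIndex_eq hp hq hβ hρ,
      h.index_zero]
  · rcases le_or_gt z 1 with hz1 | hz1
    · refine .inl ⟨⟨hz, hz1⟩, ?_⟩
      rw [RestlessProject.mpIndexExt, IccExtend_of_mem _ _ ⟨hz, hz1⟩, mpIndex_eq hp hq hβ hρ]
    · refine .inr (.inr ⟨hz1.le, ?_⟩)
      rw [RestlessProject.mpIndexExt, IccExtend_of_right_le _ _ hz1.le, mpIndex_eq hp hq hβ hρ,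
        h.index_one]

include hp hq hβ in
-- Monotonicity of `G` needs two distinct prices. The extended index is constant outside `[0, 1]`,
-- but there any price `≤ 0`, respectively `≥ 1`, matches the threshold.
lemma exists_matching_lt {z₁ z₂ : ℝ} (hz : z₁ < z₂) : ∃ c₁ c₂, c₁ < c₂ ∧
    IsMatching q (1 - p - q) β z₁ c₁ ∧ IsMatching q (1 - p - q) β z₂ c₂ := by
  have h := admissible hρ hp hq hβ
  have hmono := h.strictMonoOn_index
  have h01 : ∀ z ∈ Icc (0 : ℝ) 1, index q (1 - p - q) β z ∈ Icc (0 : ℝ) 1 := fun z hz =>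
    h.index_mem hz
  rcases lt_or_ge z₁ 0 with h1 | h1
  · rcases lt_or_ge z₂ 0 with h2 | h2
    · exact ⟨-1, 0, by norm_num, .inr (.inl ⟨h1, by norm_num⟩), .inr (.inl ⟨h2, le_rfl⟩)⟩
    · rcases le_or_gt z₂ 1 with h3 | h3
      · exact ⟨-1, _, by linarith [(h01 z₂ ⟨h2, h3⟩).1], .inr (.inl ⟨h1, by norm_num⟩),
          .inl ⟨⟨h2, h3⟩, rfl⟩⟩
      · exact ⟨-1, 1, by norm_num, .inr (.inl ⟨h1, by norm_num⟩), .inr (.inr ⟨h3.le, le_rfl⟩)⟩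
  · rcases lt_or_ge z₂ 1 with h2 | h2
    · exact ⟨_, _, hmono ⟨h1, (hz.trans h2).le⟩ ⟨h1.trans hz.le, h2.le⟩ hz,
        .inl ⟨⟨h1, (hz.trans h2).le⟩, rfl⟩, .inl ⟨⟨h1.trans hz.le, h2.le⟩, rfl⟩⟩
    · rcases le_or_gt z₁ 1 with h3 | h3
      · exact ⟨_, 2, by linarith [(h01 z₁ ⟨h1, h3⟩).2], .inl ⟨⟨h1, h3⟩, rfl⟩,
          .inr (.inr ⟨h2, by norm_num⟩)⟩
      · exact ⟨1, 2, by norm_num, .inr (.inr ⟨h3.le, le_rfl⟩), .inr (.inr ⟨h2, by norm_num⟩)⟩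

/-- Adding the two optimality inequalities, each policy being optimal at its own price, cancels the
rewards and leaves `(c₂ - c₁) (G z₂ - G z₁) ≤ 0`. -/
lemma antitone_resourceMetric (x : Icc (0 : ℝ) 1) : Antitone fun z : ℝ =>
    (project p q β hp hq hβ).resourceMetric x (thresholdPolicy 0 1 (z : EReal)) := by
  intro z₁ z₂ hz
  rcases hz.eq_or_lt with rfl | hz
  · exact le_rfl
  obtain ⟨c₁, c₂, hc, h1, h2⟩ := exists_matching_lt hp hq hβ hρ hz
  have h3 := netValue_le_of_matching hp hq hβ hρ h1 x (thresholdPolicy 0 1 (z₂ : EReal))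
  have h4 := netValue_le_of_matching hp hq hβ hρ h2 x (thresholdPolicy 0 1 (z₁ : EReal))
  simp only [RestlessProject.netValue] at h3 h4
  dsimp only
  nlinarith

lemma continuousWithinAt_resourceMetric (x : Icc (0 : ℝ) 1) (z : ℝ) :
    ContinuousWithinAt (fun z : ℝ =>
      (project p q β hp hq hβ).resourceMetric x (thresholdPolicy 0 1 (z : EReal))) (Ici z) z := by
  obtain ⟨AF, AG, N, hev⟩ := (admissible hρ hp hq hβ).exists_thresholdMetrics z
  refine (continuousWithinAt_const (b := waitValue q (1 - p - q) β z AG N x)).congr_of_eventuallyEq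
    ?_ ?_
  · filter_upwards [hev, eventually_waitValue_eq (q := q) (ρ := 1 - p - q) (β := β) (z := z)
      (A := AG) N x] with z' hz' hw'
    rw [resourceMetric_threshold hp hq hβ hz' (coe_lt_coe_iff z'), hw']
  · rw [resourceMetric_threshold hp hq hβ (hev.self_of_nhdsWithin self_mem_Ici) (coe_lt_coe_iff z)]

lemma pcli3 : (project p q β hp hq hβ).PCLI3 := by
  intro x
  let S : StieltjesFunction ℝ :=
    { toFun := fun z =>
        -(project p q β hp hq hβ).resourceMetric x (thresholdPolicy 0 1 (z : EReal))
      mono' := fun _ _ hz => neg_le_neg (antitone_resourceMetric hp hq hβ hρ x hz)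
      right_continuous' := fun z => (continuousWithinAt_resourceMetric hp hq hβ hρ x z).neg }
  have hm : Monotone (project p q β hp hq hβ).mpIndexExt :=
    (mpIndex_strictMono hp hq hβ hρ).monotone.IccExtend _
  have hc : Continuous (project p q β hp hq hβ).mpIndexExt :=
    (continuous_mpIndex hp hq hβ hρ).Icc_extend'
  refine ⟨S, fun _ => rfl, fun z₁ z₂ hz => ⟨hc.integrableOn_Ioc, ?_⟩⟩
  have key := S.sub_eq_setIntegral (H := fun z =>
    -(project p q β hp hq hβ).rewardMetric x (thresholdPolicy 0 1 (z : EReal))) hm hc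
    (fun a b hab => ?_) hz
  · rw [← key]
    ring
  -- With `S = -G` and `H = -F`, optimality of the `a`-policy at price `m a` is the lower bound on
  -- `H b - H a`, and optimality of the `b`-policy at price `m b` is the upper one.
  · have h1 := isMatching_mpIndexExt hp hq hβ hρ a
    have h2 := isMatching_mpIndexExt hp hq hβ hρ b
    have h3 := netValue_le_of_matching hp hq hβ hρ h1 x (thresholdPolicy 0 1 (b : EReal))
    have h4 := netValue_le_of_matching hp hq hβ hρ h2 x (thresholdPolicy 0 1 (a : EReal))
    have hS : ∀ z, S z =
      -(project p q β hp hq hβ).resourceMetric x (thresholdPolicy 0 1 (z : EReal)) := fun _ => rfl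
    simp only [RestlessProject.netValue] at h3 h4
    rw [hS, hS]
    constructor <;> linarith

include hp hq hβ in
lemma exists_index_eq {c : ℝ} (hc : c ∈ Icc (0 : ℝ) 1) :
    ∃ z ∈ Icc (0 : ℝ) 1, index q (1 - p - q) β z = c := by
  have h := admissible hρ hp hq hβ
  have := intermediate_value_Icc zero_le_one h.continuousOn_index
  rw [h.index_zero, h.index_one] at this
  exact this hc

include hp hq hβ in
/-- For every price there is a threshold at which the sign of the marginal net value separates the
states, and this sign is the one of the index minus the price. -/
lemma exists_threshold (c : ℝ) : ∃ (z : ℝ) (F AF G AG : ℝ → ℝ),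
    ThresholdMetrics q (1 - p - q) β z F AF G AG ∧ ∀ x ∈ Icc (0 : ℝ) 1,
      (x = z → AF x - c * AG x =
        β * (F (drift q (1 - p - q) x) - c * G (drift q (1 - p - q) x)) ∧
        index q (1 - p - q) β x = c) ∧
      (x < z → AF x - c * AG x <
        β * (F (drift q (1 - p - q) x) - c * G (drift q (1 - p - q) x)) ∧
        index q (1 - p - q) β x < c) ∧
      (z < x → β * (F (drift q (1 - p - q) x) - c * G (drift q (1 - p - q) x)) <
        AF x - c * AG x ∧ c < index q (1 - p - q) β x) := by
  have h := admissible hρ hp hq hβ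
  have hmono := h.strictMonoOn_index
  by_cases hc : c ∈ Icc (0 : ℝ) 1
  · obtain ⟨z, hz, rfl⟩ := exists_index_eq hp hq hβ hρ hc
    obtain ⟨F, AF, G, AG, hM⟩ := exists_metrics hp hq hβ hρ z
    refine ⟨z, F, AF, G, AG, hM, fun x hx => ⟨?_, fun hxz => ⟨?_, hmono hx hz hxz⟩,
      fun hxz => ⟨?_, hmono hz hx hxz⟩⟩⟩
    · rintro rfl
      exact ⟨by linarith [hM.marginal_eq hz], rfl⟩
    · linarith [(hM.marginal_sign h hz hx).1 hxz]
    · linarith [(hM.marginal_sign h hz hx).2 hxz]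
  -- The index takes values in `[0, 1]`. A negative price makes activity strictly better everywhere,
  -- and a price above `1` makes passivity so; `-1` and `2` are thresholds outside the state space,
  -- so no state ties.
  · rcases not_and_or.1 hc with hc | hc
    · obtain ⟨F, AF, G, AG, hM⟩ := exists_metrics hp hq hβ hρ (-1)
      refine ⟨-1, F, AF, G, AG, hM, fun x hx => ⟨fun hxz => ?_, fun hxz => ?_, fun _ => ⟨?_, ?_⟩⟩⟩
      · linarith [hx.1]
      · linarith [hx.1]
      · obtain ⟨h1, h2⟩ := hM.outer (.inl (by norm_num)) x hx
        have : c * (AG x - β * G (drift q (1 - p - q) x)) = c := by rw [h2, mul_one]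
        linarith [hx.1]
      · exact (not_le.1 hc).trans_le (h.index_mem hx).1
    · obtain ⟨F, AF, G, AG, hM⟩ := exists_metrics hp hq hβ hρ 2
      refine ⟨2, F, AF, G, AG, hM, fun x hx => ⟨fun hxz => ?_, fun _ => ⟨?_, ?_⟩, fun hxz => ?_⟩⟩
      · linarith [hx.2]
      · obtain ⟨h1, h2⟩ := hM.outer (.inr (by norm_num)) x hx
        have : c * (AG x - β * G (drift q (1 - p - q) x)) = c := by rw [h2, mul_one]
        linarith [hx.2]
      · exact (h.index_mem hx).2.trans_lt (not_le.1 hc)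
      · linarith [hx.2]

lemma isStronglyThresholdIndexable :
    (project p q β hp hq hβ).IsStronglyThresholdIndexableWith
      (project p q β hp hq hβ).mpIndex := by
  have main : ∀ c, ((project p q β hp hq hβ).optimalActionSet c true =
        {x | c ≤ (project p q β hp hq hβ).mpIndex x} ∧
      (project p q β hp hq hβ).optimalActionSet c false =
        {x | (project p q β hp hq hβ).mpIndex x ≤ c}) ∧ ∃ z : EReal,
      (project p q β hp hq hβ).IsOptimal c (thresholdPolicy 0 1 z) ∧
      (project p q β hp hq hβ).IsOptimal c (thresholdPolicyLeft 0 1 z) := by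
    intro c
    obtain ⟨z, F, AF, G, AG, hM, hs⟩ := exists_threshold hp hq hβ hρ c
    have hV := hM.reward.sub_mul hM.resource c
    have hle : ∀ x ∈ Icc (0 : ℝ) 1, x ≤ z → AF x - c * AG x ≤
        β * (F (drift q (1 - p - q) x) - c * G (drift q (1 - p - q) x)) := fun x hx hxz =>
      hxz.eq_or_lt.elim (fun he => ((hs x hx).1 he).1.le) fun hl => ((hs x hx).2.1 hl).1.le
    have hge : ∀ x ∈ Icc (0 : ℝ) 1, z ≤ x →
        β * (F (drift q (1 - p - q) x) - c * G (drift q (1 - p - q) x)) ≤ AF x - c * AG x :=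
      fun x hx hxz => hxz.eq_or_lt.elim (fun he => ((hs x hx).1 he.symm).1.ge)
        fun hl => ((hs x hx).2.2 hl).1.le
    have hge' := fun x hx (hxz : z < x) => hge x hx hxz.le
    have hB := bellman_ofRegion hp hq hβ hV hle hge' (measurableSet_above (z : EReal))
      (fun x hx => hge' x x.2 ((coe_lt_coe_iff z x).1 hx))
      (fun x hx => hle x x.2 (not_lt.1 fun hlt => hx ((coe_lt_coe_iff z x).2 hlt)))
    -- The two policies differ only at the state `z`, where both actions are optimal.
    have hB' := bellman_ofRegion hp hq hβ hV hle hge' (measurableSet_atLeast (z : EReal))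
      (fun x hx => hge x x.2 (EReal.coe_le_coe_iff.1 hx))
      (fun x hx => hle x x.2 (le_of_lt (not_le.1 fun hlt => hx (EReal.coe_le_coe_iff.2 hlt))))
    have htrue : ∀ x : Icc (0 : ℝ) 1,
        (project p q β hp hq hβ).actionValue c true x = AF x - c * AG x := fun x => by
      have h1 := congrFun (net_eq hp hq hβ c) x
      have h2 := congrFun h1 true
      rw [RestlessProject.actionValue, hB.2.2,
        integral_transition_true hp hq hβ (fun y => F y - c * G y), hV.first x]
      exact congrArg (· + _) (h2.trans (if_pos rfl))
    have hfalse : ∀ x : Icc (0 : ℝ) 1, (project p q β hp hq hβ).actionValue c false x =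
        β * (F (drift q (1 - p - q) x) - c * G (drift q (1 - p - q) x)) := fun x => by
      have h1 := congrFun (net_eq hp hq hβ c) x
      have h2 := congrFun h1 false
      rw [RestlessProject.actionValue, hB.2.2,
        integral_transition_false hp hq hβ (fun y => F y - c * G y)]
      exact (congrArg (· + _) (h2.trans (if_neg Bool.false_ne_true))).trans (zero_add _)
    refine ⟨⟨?_, ?_⟩, z, hB.2.1, hB'.2.1⟩
    · ext x
      simp only [RestlessProject.optimalActionSet, mem_ofPred_eq, Bool.not_true, htrue, hfalse,
        mpIndex_eq hp hq hβ hρ]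
      obtain ⟨h1, h2, h3⟩ := hs x x.2
      rcases lt_trichotomy (x : ℝ) z with hx | hx | hx
      · exact iff_of_false (h2 hx).1.not_ge (h2 hx).2.not_ge
      · exact iff_of_true (h1 hx).1.ge (h1 hx).2.ge
      · exact iff_of_true (h3 hx).1.le (h3 hx).2.le
    · ext x
      simp only [RestlessProject.optimalActionSet, mem_ofPred_eq, Bool.not_false, htrue, hfalse,
        mpIndex_eq hp hq hβ hρ]
      obtain ⟨h1, h2, h3⟩ := hs x x.2
      rcases lt_trichotomy (x : ℝ) z with hx | hx | hx
      · exact iff_of_true (h2 hx).1.le (h2 hx).2.le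
      · exact iff_of_true (h1 hx).1.le (h1 hx).2.le
      · exact iff_of_false (h3 hx).1.not_ge (h3 hx).2.not_ge
  exact ⟨fun c => (main c).1, fun c => (main c).2⟩

end GilbertElliott

theorem mainTheorem9 (p q β : ℝ) (hp : p ∈ Set.Icc (0 : ℝ) 1) (hq : q ∈ Set.Icc (0 : ℝ) 1)
    (hρ : 0 < 1 - p - q) (hβ : β ∈ Set.Ico (0 : ℝ) 1) :
    (GilbertElliott.project p q β hp hq hβ).IsPCLIndexable ∧
      (GilbertElliott.project p q β hp hq hβ).IsStronglyThresholdIndexableWith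
        (GilbertElliott.project p q β hp hq hβ).mpIndex :=
  ⟨⟨GilbertElliott.pcli1 hp hq hβ hρ, GilbertElliott.pcli2 hp hq hβ hρ,
    GilbertElliott.pcli3 hp hq hβ hρ⟩, GilbertElliott.isStronglyThresholdIndexable hp hq hβ hρ⟩
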